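/- Let $c_0$ and $\ell_1$ be the spaces of real sequences that tend to $0$, respectively are absolutely summable. For a linear subspace $L\subseteq\mathbb R^{\mathbb N}$ let $\mathbb R^{\mathbb N}/L$ denote the equivalence relation on $\mathbb R^{\mathbb N}$ in which $a,b$ are equivalent iff $a-b\in L$. For equivalence relations $E,F$ on Polish spaces $X,Y$, write $E\le_B F$ ($E$ is Borel reducible to $F$) if there is a Borel map $\theta:X\to Y$ with $(x,y)\in E\iff(\theta(x),\theta(y))\in F$ for all $x,y\in X$; write $E<_BF$ if $E\le_BF$ and $F\not\le_BE$; and let $E\otimes F$ be the equivalence relation on $X\times Y$ in which $(x_1,y_1),(x_2,y_2)$ are equivalent iff $(x_1,x_2)\in E$ and $(y_1,y_2)\in F$. For $m\ge1$ let $(e^i_k)_{k\in\mathbb N}$ be the unit vectors of the $i$-th summand of the Banach space $\bigoplus_{i=1}^m c_0$ (sup norm), put $x^m_{mj+i-1}=\sum_{k\le j}e^i_k$ for $1\le i\le m$ and $j\in\mathbb N=\{0,1,\dots\}$, and let $$\mathrm{cs}^{(m)}=\Big\{a\in\mathbb R^{\mathbb N}:\ \sum_n a(n)\,x^m_n\ \text{converges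 in}\ \bigoplus_{i=1}^m c_0\Big\}.$$ Let $\langle\cdot,\cdot\rangle:\mathbb N^2\to\mathbb N$ be any bijection such that for every $i$ the map $j\mapsto\langle i,j\rangle$ is strictly increasing, and let $$\mathrm{bv}_0^{(\infty)}=c_0\cap\Big\{a\in\mathbb R^{\mathbb N}:\ \sum_i\sum_j\big|a(\langle i,j\rangle)-a(\langle i,j+1\rangle)\big|<\infty\Big\}.$$ Then: (i) $\mathbb R^{\mathbb N}/\ell_1\not\le_B\mathbb R^{\mathbb N}/\mathrm{cs}^{(m)}$ for every integer $m\ge1$; (ii) $\mathbb R^{\mathbb N}/c_0\not\le_B\mathbb R^{\mathbb N}/\mathrm{bv}_0^{(\infty)}$; (iii) $\mathbb R^{\mathbb N}/\mathrm{bv}_0^{(\infty)}<_B\mathbb R^{\mathbb N}/\ell_1\otimes\mathbb R^{\mathbb N}/c_0$. -/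

import Mathlib

open Filter Topology

/-! ## Borel reducibility -/

/-- `E ≤_B F` for equivalence relations `E`, `F` on Polish spaces: there is a Borel map `θ` with
`(x, y) ∈ E ↔ (θ x, θ y) ∈ F`. -/
def BorelReducible {X Y : Type*}
    [TopologicalSpace X] [PolishSpace X] [MeasurableSpace X] [BorelSpace X]
    [TopologicalSpace Y] [PolishSpace Y] [MeasurableSpace Y] [BorelSpace Y]
    (E : Setoid X) (F : Setoid Y) : Prop :=
  ∃ θ : X → Y, Measurable θ ∧ ∀ x y : X, E x y ↔ F (θ x) (θ y)

/-- `E <_B F`: `E ≤_B F` and not `F ≤_B E`. -/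
def StrictBorelReducible {X Y : Type*}
    [TopologicalSpace X] [PolishSpace X] [MeasurableSpace X] [BorelSpace X]
    [TopologicalSpace Y] [PolishSpace Y] [MeasurableSpace Y] [BorelSpace Y]
    (E : Setoid X) (F : Setoid Y) : Prop :=
  BorelReducible E F ∧ ¬ BorelReducible F E

/-- The equivalence relation `ℝ^ℕ / L`: `a` and `b` are equivalent iff `a - b ∈ L`. -/
def seqMod (L : Submodule ℝ (ℕ → ℝ)) : Setoid (ℕ → ℝ) where
  r a b := a - b ∈ L
  iseqv :=
    { refl := fun a => by simp
      symm := fun {a b} h => by simpa using L.neg_mem h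
      trans := fun {a b c} h₁ h₂ => by simpa using L.add_mem h₁ h₂ }

/-! ## Sequence spaces -/

/-- `ℓ₁`, as a space of real sequences. -/
def ellOne : Submodule ℝ (ℕ → ℝ) where
  carrier := {a | Summable fun n => |a n|}
  zero_mem' := by simp [summable_zero]
  add_mem' := fun {a b} ha hb => (summable_abs_iff.1 ha |>.add (summable_abs_iff.1 hb)).abs
  smul_mem' := fun c a ha => (summable_abs_iff.1 ha |>.mul_left c).abs

/-- `c₀`, as a space of real sequences. -/
def cZero : Submodule ℝ (ℕ → ℝ) where
  carrier := {a | Tendsto a atTop (𝓝 0)}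
  zero_mem' := tendsto_const_nhds
  add_mem' := fun {a b} ha hb => by
    have h := Tendsto.add ha hb
    rwa [add_zero] at h
  smul_mem' := fun c a ha => by
    have h := Tendsto.const_smul ha c
    rwa [smul_zero] at h

/-- `coef(X, (xₙ))`: the real sequences `a` such that `∑ₙ a(n) xₙ` converges in `X`
(convergence of the sequence of partial sums). -/
def coef {X : Type*} [NormedAddCommGroup X] [NormedSpace ℝ X] (x : ℕ → X) :
    Submodule ℝ (ℕ → ℝ) where
  carrier := {a | ∃ l : X, Tendsto (fun N => ∑ n ∈ Finset.range N, a n • x n) atTop (𝓝 l)}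
  zero_mem' := ⟨0, by simp⟩
  add_mem' := by
    rintro a b ⟨l, hl⟩ ⟨l', hl'⟩
    refine ⟨l + l', (hl.add hl').congr fun N => ?_⟩
    simp [add_smul, Finset.sum_add_distrib]
  smul_mem' := by
    rintro c a ⟨l, hl⟩
    refine ⟨c • l, (hl.const_smul c).congr fun N => ?_⟩
    simp [Finset.smul_sum, mul_smul]

/-- The unit vector `e_k` of the Banach space `c₀`, the latter being the space
`ZeroAtInftyContinuousMap ℕ ℝ` of real functions on `ℕ` vanishing at infinity, with the sup norm. -/
def unitC (k : ℕ) : ZeroAtInftyContinuousMap ℕ ℝ where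
  toFun := Pi.single k 1
  continuous_toFun := continuous_of_discreteTopology
  zero_at_infty' := by
    rw [cocompact_eq_cofinite]
    refine tendsto_const_nhds.congr' ?_
    filter_upwards [(Set.finite_singleton k).compl_mem_cofinite] with n hn
    exact (Pi.single_eq_of_ne (M := fun _ : ℕ => ℝ) hn 1).symm

/-- The sequence `x^m_n` in the sup-normed direct sum `c₀ ⊕ ⋯ ⊕ c₀` of `m` copies of `c₀`.
With the summands indexed by `i = 0, …, m - 1`, it is `x^m_{mj+i} = ∑_{k ≤ j} e^i_k`,
where `e^i_k` is the `k`-th unit vector of the `i`-th summand (for `m ≥ 1`). -/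
noncomputable def csBasis (m : ℕ) (n : ℕ) : Fin m → ZeroAtInftyContinuousMap ℕ ℝ :=
  fun i => if (i : ℕ) = n % m then ∑ k ∈ Finset.range (n / m + 1), unitC k else 0

/-- `cs^(m) = coef(c₀ ⊕ ⋯ ⊕ c₀, (x^m_n))`, for `m ≥ 1`. -/
noncomputable def cs (m : ℕ) : Submodule ℝ (ℕ → ℝ) := coef (csBasis m)

/-- `bv^(∞)`, for a bijection `φ = ⟨·,·⟩ : ℕ × ℕ → ℕ`: the sequences `a` with
`∑_i ∑_j |a(⟨i,j⟩) - a(⟨i,j+1⟩)| < ∞`. -/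
def bvInfty (φ : ℕ × ℕ ≃ ℕ) : Submodule ℝ (ℕ → ℝ) where
  carrier := {a | Summable fun p : ℕ × ℕ => |a (φ (p.1, p.2)) - a (φ (p.1, p.2 + 1))|}
  zero_mem' := by simp [summable_zero]
  add_mem' := fun {a b} ha hb =>
    ((summable_abs_iff.1 ha |>.add (summable_abs_iff.1 hb)).congr fun p => by
      simp only [Pi.add_apply]; ring).abs
  smul_mem' := fun c a ha =>
    ((summable_abs_iff.1 ha |>.mul_left c).congr fun p => by
      simp only [Pi.smul_apply, smul_eq_mul]; ring).abs

/-- `bv₀^(∞) = bv^(∞) ∩ c₀`. -/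
def bvZeroInfty (φ : ℕ × ℕ ≃ ℕ) : Submodule ℝ (ℕ → ℝ) := bvInfty φ ⊓ cZero

/-! Both non-reducibility results rest on one normal form. Sort the indices into infinitely many
infinite classes (the first coordinate of `Nat.unpair`) and give every index of class c the weight
1/(c+1). A Borel reduction to ℝ^ℕ/L, restricted to sequences that select a set of weights, is a
Borel map θ on Cantor space. Baire category yields a point z, sparse coordinates n_i and consecutive
blocks of ℕ such that for A ⊆ {n_i} the i-th block of θ(z △ A) depends only on whether n_i ∈ A, up
to errors summable in i (`exists_skeleton`). So there is a sequence v such that, for all signs s_i ∈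
{0, 1, -1}, multiplying the i-th block of v by s_i gives an element of L iff (s_i w_i) lies in the
source space, w_i being the weights (`exists_block_form_of_borelReducible`).

c₀ against bv₀^(∞): choose blocks so sparse that no chain steps directly from one to another; their
variations then add up. Inside one class the weights are constant, so the total variation must be
infinite, and finitely many blocks of the class already have variation at least 1. The union of
these finite sets over all classes has weights tending to 0, yet infinite variation.

ℓ₁ against cs^(m): cs^(m) is a coefficient space in the finite-dimensional ℝ^m. Blocks of large
class have bounded sums, so by compactness each such class contains two blocks with almost equal
sums. Taking them with opposite signs gives a convergent series, while the source sees only absolute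
values and receives a divergent harmonic series.

For (iii), a maps to its chain increments together with a itself. Since c₀ reduces to the product, a
converse reduction would contradict (ii). -/

open scoped ENNReal

/-! ## Baire category on `ℕ → Bool` -/

/-- A Borel map into a second countable space is continuous on a residual set. -/
theorem exists_residual_continuousOn {X Y : Type*} [TopologicalSpace X] [MeasurableSpace X]
    [BorelSpace X] [TopologicalSpace Y] [SecondCountableTopology Y] [MeasurableSpace Y]
    [OpensMeasurableSpace Y] {f : X → Y} (hf : Measurable f) :
    ∃ G ∈ residual X, ContinuousOn f G := by
  have hB := TopologicalSpace.isBasis_countableBasis Y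
  have key : ∀ V : TopologicalSpace.countableBasis Y, ∃ O : Set X, IsOpen O ∧
      ∀ᶠ x in residual X, (x ∈ f ⁻¹' (V : Set Y) ↔ x ∈ O) := by
    intro V
    obtain ⟨O, hO, h⟩ := (hf (hB.isOpen V.2).measurableSet).residualEq_isOpen
    exact ⟨O, hO, h.mem_iff⟩
  choose O hO h using key
  have : Countable (TopologicalSpace.countableBasis Y) :=
    (TopologicalSpace.countable_countableBasis Y).to_subtype
  refine ⟨{x | ∀ V : TopologicalSpace.countableBasis Y, x ∈ f ⁻¹' (V : Set Y) ↔ x ∈ O V}, eventually_countable_forall.2 h, ?_⟩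
  intro x hx
  rw [ContinuousWithinAt, hB.nhds_hasBasis.tendsto_right_iff]
  rintro V ⟨hV, hxV⟩
  have hxO : x ∈ O ⟨V, hV⟩ := (hx ⟨V, hV⟩).1 hxV
  filter_upwards [mem_nhdsWithin_of_mem_nhds ((hO ⟨V, hV⟩).mem_nhds hxO),
    self_mem_nhdsWithin] with y hy hy'
  exact (hy' ⟨V, hV⟩).2 hy

/-- Switch the coordinates of `y` that are marked in `F`. -/
def toggle (y F : ℕ → Bool) : ℕ → Bool := fun n => xor (y n) (F n)

/-- The indicator function of a finite set. -/
def finMask (F : Finset ℕ) : ℕ → Bool := fun n => decide (n ∈ F)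

theorem toggle_toggle (y F : ℕ → Bool) : toggle (toggle y F) F = y := by
  funext n; simp [toggle]

theorem continuous_toggle (F : ℕ → Bool) : Continuous fun y => toggle y F :=
  continuous_pi fun n => (continuous_of_discreteTopology (f := fun b => xor b (F n))).comp
    (continuous_apply n)

/-- The homeomorphism that switches the coordinates marked in `F`. -/
def toggleHomeomorph (F : ℕ → Bool) : (ℕ → Bool) ≃ₜ (ℕ → Bool) where
  toFun y := toggle y F
  invFun y := toggle y F
  left_inv y := toggle_toggle y F
  right_inv y := toggle_toggle y F
  continuous_toFun := continuous_toggle F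
  continuous_invFun := continuous_toggle F

/-- There are only countably many finite switches, and each is a homeomorphism, hence preserves
residual sets. -/
theorem exists_forall_toggle_mem {t : Set (ℕ → Bool)} (ht : t ∈ residual (ℕ → Bool)) :
    ∃ z, ∀ F : Finset ℕ, toggle z (finMask F) ∈ t := by
  have h : ∀ᶠ z in residual (ℕ → Bool), ∀ F : Finset ℕ, toggle z (finMask F) ∈ t := by
    refine eventually_countable_forall.2 fun F => ?_
    have := (toggleHomeomorph (finMask F)).residual_map_eq
    exact (this.le : Tendsto _ _ _) ht
  exact (dense_of_mem_residual h).nonempty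

theorem exists_cylinder_subset {O : Set (ℕ → Bool)} (hO : IsOpen O) {x : ℕ → Bool} (hx : x ∈ O) :
    ∃ m, ∀ y : ℕ → Bool, (∀ n < m, y n = x n) → y ∈ O := by
  obtain ⟨I, u, hu, hI⟩ := isOpen_pi_iff.1 hO x hx
  refine ⟨I.sup id + 1, fun y hy => hI fun n hn => ?_⟩
  rw [hy n (Nat.lt_succ_of_le (Finset.le_sup (f := id) hn))]
  exact (hu n hn).2

theorem exists_cylinder_of_nhdsWithin {G O : Set (ℕ → Bool)} {x : ℕ → Bool}
    (hO : O ∈ 𝓝[G] x) :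
    ∃ m, ∀ y ∈ G, (∀ n < m, y n = x n) → y ∈ O := by
  obtain ⟨V, hV, hxV, h⟩ := mem_nhdsWithin.1 hO
  obtain ⟨m, hm⟩ := exists_cylinder_subset hV hxV
  exact ⟨m, fun y hy hyx => h ⟨hm y hyx, hy⟩⟩

/-- A generic point `z` for a Borel map `θ` and a countable family of Borel sets. -/
theorem exists_generic {Y ι : Type*} [Countable ι] [TopologicalSpace Y]
    [SecondCountableTopology Y] [MeasurableSpace Y] [BorelSpace Y] {θ : (ℕ → Bool) → Y}
    (hθ : Measurable θ) {B : ι → Set (ℕ → Bool)} (hB : ∀ j, MeasurableSet (B j)) :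
    ∃ (U : ℕ → Set (ℕ → Bool)) (z : ℕ → Bool), (∀ j, IsOpen (U j)) ∧
      (∀ F : Finset ℕ, toggle z (finMask F) ∈ ⋂ j, U j) ∧ ContinuousOn θ (⋂ j, U j) ∧
      ∀ j, z ∈ B j → ∃ m, ∀ y ∈ ⋂ j, U j, (∀ n < m, y n = z n) → y ∈ B j := by
  classical
  obtain ⟨G₁, hG₁, hc₁⟩ := exists_residual_continuousOn hθ
  -- All the sets `B j` are coded by one Borel map to a power of `Bool`. Where that map is
  -- continuous, membership in `B j` is decided by a finite initial segment.
  have hm : Measurable fun (x : ℕ → Bool) (j : ι) => decide (x ∈ B j) := by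
    refine measurable_pi_iff.2 fun j => measurable_to_bool ?_
    convert hB j
    ext x
    simp
  obtain ⟨G₂, hG₂, hc₂⟩ := exists_residual_continuousOn hm
  obtain ⟨t, hts, htG, htd⟩ := mem_residual.1 (inter_mem hG₁ hG₂)
  obtain ⟨U, hU, rfl⟩ := htG.eq_iInter_nat
  obtain ⟨z, hz⟩ := exists_forall_toggle_mem (residual_of_dense_Gδ htG htd)
  have hz0 : z ∈ ⋂ j, U j := by
    have h0 : toggle z (finMask ∅) = z := by funext n; simp [toggle, finMask]
    exact h0 ▸ hz ∅
  refine ⟨U, z, hU, hz, hc₁.mono fun x hx => (hts hx).1, fun j hj => ?_⟩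
  have hcz := (hc₂.mono fun x hx => (hts hx).2) z hz0
  have hO := (continuousWithinAt_pi.1 hcz j).eventually
    ((isOpen_discrete {true}).mem_nhds (by simp [hj]))
  obtain ⟨m, h⟩ := exists_cylinder_of_nhdsWithin hO
  exact ⟨m, fun y hy hyz => of_decide_eq_true (h y hy hyz)⟩

/-! ## Skeletons of Borel maps on `ℕ → Bool` -/

/-- The restriction of a sequence to the interval `[p, q)`. -/
noncomputable def cut (p q : ℕ) (a : ℕ → ℝ) : ℕ → ℝ := Set.indicator (Set.Ico p q) a

/-- `N` measures the size of sequences in such a way that `L` consists of the sequences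
whose tails are small. -/
structure IsTailGauge (L : Submodule ℝ (ℕ → ℝ)) (N : (ℕ → ℝ) → ℝ≥0∞) : Prop where
  measurable : Measurable N
  sub_le : ∀ a b, N (a - b) ≤ N a + N b
  -- The factor 2 is for the chain variation, where a coordinate enters up to two increments.
  le_tsum : ∀ a, N a ≤ 2 * ∑' k, ‖a k‖ₑ
  small : ∀ a ∈ L, ∀ ε : ℝ≥0∞, 0 < ε → ∃ l, ∀ p q, l ≤ p → N (cut p q a) ≤ ε
  glue : ∀ (l : ℕ → ℕ) (a : ℕ → ℝ), StrictMono l → l 0 = 0 →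
    ∑' i, N (cut (l i) (l (i + 1)) a) ≠ ∞ → a ∈ L

theorem cut_apply (p q : ℕ) (a : ℕ → ℝ) (k : ℕ) :
    cut p q a k = if p ≤ k ∧ k < q then a k else 0 := by
  simp [cut, Set.indicator_apply]

theorem measurable_cut (p q : ℕ) : Measurable (cut p q) := by
  refine measurable_pi_iff.2 fun k => ?_
  simp only [cut_apply]
  split_ifs
  · exact measurable_pi_apply k
  · exact measurable_const

theorem cut_sub (p q : ℕ) (a b : ℕ → ℝ) : cut p q (a - b) = cut p q a - cut p q b :=
  Set.indicator_sub' _ _ _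

theorem cut_zero (p q : ℕ) : cut p q 0 = 0 := Set.indicator_zero' _

namespace IsTailGauge

variable {L : Submodule ℝ (ℕ → ℝ)} {N : (ℕ → ℝ) → ℝ≥0∞}

theorem map_zero (h : IsTailGauge L N) : N 0 = 0 := by simpa using h.le_tsum 0

theorem add_le (h : IsTailGauge L N) (a b : ℕ → ℝ) : N (a + b) ≤ N a + N b := by
  have h1 := h.sub_le a (0 - b)
  have h2 := h.sub_le 0 b
  rw [h.map_zero, zero_add] at h2
  rw [zero_sub, sub_neg_eq_add] at h1
  rw [zero_sub] at h2
  exact h1.trans (by gcongr)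

theorem cut_le_sum (h : IsTailGauge L N) (p q : ℕ) (a : ℕ → ℝ) :
    N (cut p q a) ≤ 2 * ∑ k ∈ Finset.range q, ‖a k‖ₑ := by
  refine (h.le_tsum _).trans ?_
  gcongr
  rw [tsum_eq_sum (s := Finset.range q)]
  · refine Finset.sum_le_sum fun k _ => ?_
    rw [cut_apply]
    split_ifs <;> simp
  · intro k hk
    rw [cut_apply, if_neg (fun h => hk (Finset.mem_range.2 h.2))]
    simp

end IsTailGauge

/-- Keep only the marks below `m`. -/
def truncMask (A : ℕ → Bool) (m : ℕ) : ℕ → Bool := fun k => A k && decide (k < m)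

/-- Keep only the mark at `m`. -/
def pickMask (A : ℕ → Bool) (m : ℕ) : ℕ → Bool := fun k => A k && decide (k = m)

theorem truncMask_eq_finMask (A : ℕ → Bool) (m : ℕ) :
    truncMask A m = finMask ((Finset.range m).filter fun k => A k = true) := by
  funext k
  cases h : A k <;> simp [truncMask, finMask, h]

theorem exists_seq {α : Type*} {P : α → Prop} {R : ℕ → α → α → Prop} (h0 : ∃ a, P a)
    (h : ∀ i a, ∃ b, R i a b) : ∃ f : ℕ → α, P (f 0) ∧ ∀ i, R i (f i) (f (i + 1)) := by
  obtain ⟨a, ha⟩ := h0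
  choose g hg using h
  exact ⟨fun i => Nat.rec a g i, ha, fun i => hg i _⟩

theorem exists_ge_unpair_fst (c m : ℕ) : ∃ n, m ≤ n ∧ n.unpair.1 = c :=
  ⟨Nat.pair c m, Nat.right_le_pair c m, by simp⟩

/-- On the block [l i, l (i+1)) the two estimates combine: marks after n i are invisible by
continuity of θ on the generic set, and marks before n i are invisible because a finite change moves
θ by an element of L, whose tail is small. Only the mark at n i remains. The generic set makes the
tail estimate hold at z with n i switched as well as at z. -/
theorem exists_skeleton {L : Submodule ℝ (ℕ → ℝ)} {N : (ℕ → ℝ) → ℝ≥0∞} (hN : IsTailGauge L N)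
    {θ : (ℕ → Bool) → ℕ → ℝ} (hθ : Measurable θ)
    (hfin : ∀ (y : ℕ → Bool) (F : Finset ℕ), θ (toggle y (finMask F)) - θ y ∈ L)
    {δ : ℕ → ℝ≥0∞} (hδ : ∀ i, 0 < δ i) :
    ∃ (z : ℕ → Bool) (n l : ℕ → ℕ), StrictMono n ∧ StrictMono l ∧ l 0 = 0 ∧
      (∀ i, (n i).unpair.1 = i.unpair.1) ∧
      ∀ A : ℕ → Bool, (∀ k, A k = true → ∃ i, n i = k) →
        (∀ i, ∑ k ∈ Finset.range (l (i + 1)),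
          ‖θ (toggle z A) k - θ (toggle z (truncMask A (n i + 1))) k‖ₑ ≤ δ (i + 1)) ∧
        ∀ i p q, l i ≤ p → N (cut p q
          (θ (toggle z (truncMask A (n i + 1))) - θ (toggle z (pickMask A (n i))))) ≤ δ i := by
  classical
  let B : ℕ × ℕ × ℕ → Set (ℕ → Bool) := fun t => {y | ∀ F ∈ (Finset.range t.1).powerset,
    ∀ p q, t.2.1 ≤ p → N (cut p q (θ (toggle y (finMask F)) - θ y)) ≤ δ t.2.2}
  have hB : ∀ t, MeasurableSet (B t) := by
    intro t
    simp only [B, Set.ofPred_forall]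
    refine MeasurableSet.iInter fun F => .iInter fun _ => .iInter fun p => .iInter fun q =>
      .iInter fun _ => measurableSet_le (hN.measurable.comp ((measurable_cut p q).comp
        ((hθ.comp (continuous_toggle _).measurable).sub hθ))) measurable_const
  obtain ⟨U, z, hU, hz, hc, hzB⟩ := exists_generic hθ hB
  set G := ⋂ j, U j with hGdef
  have stageB : ∀ i k, ∃ l, z ∈ B (k, l, i) := by
    intro i k
    have h1 : ∀ F : Finset ℕ, ∃ l, ∀ p q, l ≤ p →
        N (cut p q (θ (toggle z (finMask F)) - θ z)) ≤ δ i :=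
      fun F => hN.small _ (hfin z F) _ (hδ i)
    choose lf hlf using h1
    exact ⟨(Finset.range k).powerset.sup lf, fun F hF p q hp =>
      hlf F p q ((Finset.le_sup hF).trans hp)⟩
  have stageA : ∀ i k l, ∃ m, ∀ F ∈ (Finset.range k).powerset, ∀ y ∈ G,
      (∀ j < m, y j = toggle z (finMask F) j) →
      ∑ j ∈ Finset.range l, ‖θ y j - θ (toggle z (finMask F)) j‖ₑ ≤ δ i := by
    intro i k l
    have h1 : ∀ F : Finset ℕ, ∃ m, ∀ y ∈ G, (∀ j < m, y j = toggle z (finMask F) j) →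
        ∑ j ∈ Finset.range l, ‖θ y j - θ (toggle z (finMask F)) j‖ₑ ≤ δ i := by
      intro F
      have h2 : Continuous fun a : ℕ → ℝ =>
          ∑ j ∈ Finset.range l, ‖a j - θ (toggle z (finMask F)) j‖ₑ :=
        continuous_finsetSum _ fun j _ => ((continuous_apply j).sub continuous_const).enorm
      have h3 := (h2.tendsto _).comp (hc _ (hz F))
      have h4 := h3.eventually (gt_mem_nhds (by simpa using hδ i))
      obtain ⟨m, hm⟩ := exists_cylinder_of_nhdsWithin h4
      exact ⟨m, fun y hy hyz => le_of_lt (hm y hy hyz)⟩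
    choose mf hmf using h1
    exact ⟨(Finset.range k).powerset.sup mf, fun F hF y hy hyz =>
      hmf F y hy fun j hj => hyz j (hj.trans_le (Finset.le_sup hF))⟩
  have stageU : ∀ i k, ∃ m, ∀ F ∈ (Finset.range k).powerset, ∀ y : ℕ → Bool,
      (∀ j < m, y j = toggle z (finMask F) j) → y ∈ U i := by
    intro i k
    have h1 : ∀ F : Finset ℕ, ∃ m, ∀ y : ℕ → Bool,
        (∀ j < m, y j = toggle z (finMask F) j) → y ∈ U i :=
      fun F => exists_cylinder_subset (hU i) (Set.mem_iInter.1 (hz F) i)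
    choose mf hmf using h1
    exact ⟨(Finset.range k).powerset.sup mf, fun F hF y hyz =>
      hmf F y fun j hj => hyz j (hj.trans_le (Finset.le_sup hF))⟩
  -- Requirements on the next coordinate m, given marks below k and block start l: agreement below m
  -- controls the values of θ below l, forces membership in the i-th open set, and preserves the
  -- tail estimate beyond l.
  let Q : ℕ → ℕ → ℕ → ℕ → Prop := fun i k l m =>
    (∀ F ∈ (Finset.range k).powerset, ∀ y ∈ G, (∀ j < m, y j = toggle z (finMask F) j) →
      ∑ j ∈ Finset.range l, ‖θ y j - θ (toggle z (finMask F)) j‖ₑ ≤ δ i) ∧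
    (∀ F ∈ (Finset.range k).powerset, ∀ y : ℕ → Bool,
      (∀ j < m, y j = toggle z (finMask F) j) → y ∈ U i) ∧
    (∀ y ∈ G, (∀ j < m, y j = z j) → y ∈ B (k, l, i))
  have stage : ∀ i k l, z ∈ B (k, l, i) → ∃ m, ∀ m' ≥ m, Q i k l m' := by
    intro i k l hzl
    obtain ⟨m1, h1⟩ := stageA i k l
    obtain ⟨m2, h2⟩ := stageU i k
    obtain ⟨m3, h3⟩ := hzB _ hzl
    refine ⟨max m1 (max m2 m3), fun m' hm' => ⟨fun F hF y hy hyz => h1 F hF y hy fun j hj => ?_,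
      fun F hF y hyz => h2 F hF y fun j hj => ?_, fun y hy hyz => h3 y hy fun j hj => ?_⟩⟩
    all_goals exact hyz j (by omega)
  have base : ∃ a : ℕ × ℕ, a.2 = 0 ∧ a.1.unpair.1 = (0 : ℕ).unpair.1 ∧ Q 0 0 a.2 a.1 := by
    have h0 : z ∈ B (0, 0, 0) := by
      intro F hF p q _
      have hF0 : F = ∅ := by simpa using hF
      have hz0 : toggle z (finMask F) = z := by funext j; simp [toggle, finMask, hF0]
      rw [hz0, sub_self, cut_zero, hN.map_zero]
      exact zero_le
    obtain ⟨m, hm⟩ := stage 0 0 0 h0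
    obtain ⟨n, hn, hc⟩ := exists_ge_unpair_fst (0 : ℕ).unpair.1 m
    exact ⟨(n, 0), rfl, hc, hm n hn⟩
  have step : ∀ (i : ℕ) (a : ℕ × ℕ), ∃ b : ℕ × ℕ, a.1 < b.1 ∧ a.2 < b.2 ∧
      b.1.unpair.1 = (i + 1).unpair.1 ∧ Q (i + 1) (a.1 + 1) b.2 b.1 := by
    intro i a
    obtain ⟨l, hl⟩ := stageB (i + 1) (a.1 + 1)
    have hl' : z ∈ B (a.1 + 1, max l (a.2 + 1), i + 1) :=
      fun F hF p q hp => hl F hF p q ((le_max_left _ _).trans hp)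
    obtain ⟨m, hm⟩ := stage _ _ _ hl'
    obtain ⟨n, hn, hc⟩ := exists_ge_unpair_fst (i + 1).unpair.1 (max m (a.1 + 1))
    exact ⟨(n, max l (a.2 + 1)), by simp at hn ⊢; omega, by simp, hc, hm n (by omega)⟩
  obtain ⟨f, ⟨hf0, hfc, hfQ⟩, hf⟩ := exists_seq base step
  have hn : StrictMono fun i => (f i).1 := strictMono_nat_of_lt_succ fun i => (hf i).1
  have hl : StrictMono fun i => (f i).2 := strictMono_nat_of_lt_succ fun i => (hf i).2.1
  refine ⟨z, fun i => (f i).1, fun i => (f i).2, hn, hl, hf0, ?_, ?_⟩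
  · rintro (_ | i)
    · exact hfc
    · exact (hf i).2.2.1
  intro A hA
  -- One past the previous selected coordinate, or 0 at the start: below n i, the set A has marks
  -- only below K i.
  let K : ℕ → ℕ := fun i => Nat.casesOn i 0 fun j => (f j).1 + 1
  have hQ : ∀ i, Q i (K i) (f i).2 (f i).1 := by
    rintro (_ | i)
    · exact hfQ
    · exact (hf i).2.2.2
  have hKn : ∀ i, K i ≤ (f i).1 := by
    rintro (_ | i)
    · exact Nat.zero_le _
    · exact hn (Nat.lt_succ_self i)
  have hgap : ∀ i k, k < (f i).1 → A k = true → k < K i := by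
    intro i k hk hAk
    obtain ⟨j, rfl⟩ := hA k hAk
    have hji : j < i := hn.lt_iff_lt.1 hk
    cases i with
    | zero => omega
    | succ i => exact Nat.lt_succ_of_le (hn.monotone (Nat.le_of_lt_succ hji))
  have htr : ∀ m, (Finset.range m).filter (fun k => A k = true) ∈ (Finset.range m).powerset :=
    fun m => Finset.mem_powerset.2 (Finset.filter_subset _ _)
  have hagree : ∀ i, ∀ j < (f i).1,
      toggle z A j = toggle z (finMask ((Finset.range (K i)).filter fun k => A k = true)) j := by
    intro i j hj
    rw [← truncMask_eq_finMask]
    have := hgap i j hj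
    cases h : A j
    · simp [toggle, truncMask, h]
    · simp [toggle, truncMask, h, this h]
  have hAG : toggle z A ∈ G :=
    Set.mem_iInter.2 fun i => (hQ i).2.1 _ (htr (K i)) _ (hagree i)
  constructor
  · intro i
    have := (hQ (i + 1)).1 _ (htr (K (i + 1))) _ hAG (hagree (i + 1))
    rwa [← truncMask_eq_finMask] at this
  · intro i p q hp
    have hP : toggle z (pickMask A (f i).1) ∈ G := by
      have h1 : pickMask A (f i).1 =
          finMask (({(f i).1} : Finset ℕ).filter fun k => A k = true) := by
        funext k
        cases h : A k <;> simp [pickMask, finMask, h]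
      rw [h1]
      exact hz _
    -- Switching n i is invisible below n i, so the tail estimate at z passes to this point. The
    -- remaining marks of the truncation lie below K i and are covered by that estimate.
    have hPz : ∀ j < (f i).1, toggle z (pickMask A (f i).1) j = z j := by
      intro j hj
      simp [toggle, pickMask, hj.ne]
    have h2 := (hQ i).2.2 _ hP hPz _ (htr (K i)) p q hp
    suffices heq : toggle z (truncMask A ((f i).1 + 1)) = toggle (toggle z (pickMask A (f i).1))
        (finMask ((Finset.range (K i)).filter fun k => A k = true)) by
      rw [← heq] at h2
      exact h2
    rw [← truncMask_eq_finMask]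
    funext j
    have h3 := hgap i j
    have h4 := hKn i
    rcases lt_trichotomy j (f i).1 with h | h | h
    · cases hj : A j
      · simp [toggle, truncMask, pickMask, hj]
      · have := h3 h hj
        simp [toggle, truncMask, pickMask, this, h.ne, h.trans (Nat.lt_succ_self _)]
    · subst h
      simp [toggle, truncMask, pickMask, not_lt.2 h4]
    · have h5 : ¬ j < K i := by omega
      have h6 : ¬ j < (f i).1 + 1 := by omega
      have h7 : j ≠ (f i).1 := by omega
      simp [toggle, truncMask, pickMask, h5, h6, h7]

/-! ## Block form of Borel reductions -/

theorem exists_block_index {l : ℕ → ℕ} (hl : StrictMono l) :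
    ∃ β : ℕ → ℕ, Monotone β ∧ Tendsto β atTop atTop ∧ ∀ i k, l i ≤ k → k < l (i + 1) → β k = i := by
  have h1 : ∀ k, ∃ i, k < l (i + 1) := fun k => ⟨k, (Nat.lt_succ_self k).trans_le (hl.le_apply)⟩
  classical
  have hle : ∀ i k, l i ≤ k → i ≤ Nat.find (h1 k) := by
    intro i k hik
    have h2 := Nat.find_spec (h1 k)
    have := hl.lt_iff_lt.1 (hik.trans_lt h2)
    omega
  refine ⟨fun k => Nat.find (h1 k), fun a b hab => ?_, ?_, fun i k hik hki => ?_⟩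
  · exact Nat.find_min' _ (hab.trans_lt (Nat.find_spec (h1 b)))
  · exact tendsto_atTop.2 fun i => (eventually_ge_atTop (l i)).mono fun k hk => hle i k hk
  · exact le_antisymm (Nat.find_min' _ hki) (hle i k hik)

/-- On block i, v is the effect on θ of switching n i alone. Signs arise by comparing two sets: A
carries the +1 and B the -1, so θ(z △ A) - θ(z △ B) is the signed sequence modulo L, while J sees
only A △ B, the support of s. -/
theorem exists_block_form {L : Submodule ℝ (ℕ → ℝ)} {N : (ℕ → ℝ) → ℝ≥0∞} (hN : IsTailGauge L N)
    {θ : (ℕ → Bool) → ℕ → ℝ} (hθ : Measurable θ) {J : (ℕ → Bool) → Prop}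
    (hJ : ∀ x y, θ x - θ y ∈ L ↔ J (toggle x y)) (hJfin : ∀ F, J (finMask F)) :
    ∃ n : ℕ → ℕ, StrictMono n ∧ (∀ i, (n i).unpair.1 = i.unpair.1) ∧
      ∃ β : ℕ → ℕ, Monotone β ∧ Tendsto β atTop atTop ∧ ∃ v : ℕ → ℝ, ∀ s : ℕ → ℝ,
        (∀ i, s i = 0 ∨ s i = 1 ∨ s i = -1) → ∀ C : ℕ → Bool,
        (∀ k, C k = true ↔ ∃ i, n i = k ∧ s i ≠ 0) →
        ((fun k => s (β k) * v k) ∈ L ↔ J C) := by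
  classical
  have hfin : ∀ (y : ℕ → Bool) (F : Finset ℕ), θ (toggle y (finMask F)) - θ y ∈ L := by
    intro y F
    rw [hJ]
    convert hJfin F using 1
    funext k
    simp only [toggle]
    cases y k <;> cases finMask F k <;> rfl
  obtain ⟨z, n, l, hn, hl, hl0, hcl, hz⟩ := exists_skeleton hN hθ hfin
    (δ := fun i => (2⁻¹ : ℝ≥0∞) ^ i) fun i => ENNReal.pow_pos (by norm_num) i
  obtain ⟨β, hβm, hβt, hβ⟩ := exists_block_index hl
  refine ⟨n, hn, hcl, β, hβm, hβt,
    fun k => θ (toggle z fun j => decide (j = n (β k))) k - θ z k, fun s hs C hC => ?_⟩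
  set v : ℕ → ℝ := fun k => θ (toggle z fun j => decide (j = n (β k))) k - θ z k with hv
  let A : ℕ → Bool := fun k => decide (∃ i, n i = k ∧ s i = 1)
  let B : ℕ → Bool := fun k => decide (∃ i, n i = k ∧ s i = -1)
  have hA : ∀ k, A k = true ↔ ∃ i, n i = k ∧ s i = 1 := fun k => by simp [A]
  have hB : ∀ k, B k = true ↔ ∃ i, n i = k ∧ s i = -1 := fun k => by simp [B]
  have hAn : ∀ i, A (n i) = true ↔ s i = 1 := fun i => by
    simp [hA, hn.injective.eq_iff]
  have hBn : ∀ i, B (n i) = true ↔ s i = -1 := fun i => by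
    simp [hB, hn.injective.eq_iff]
  have hCAB : toggle (toggle z A) (toggle z B) = C := by
    funext k
    rw [Bool.eq_iff_iff, hC]
    have h1 : toggle (toggle z A) (toggle z B) k = xor (A k) (B k) := by
      simp only [toggle]
      cases z k <;> cases A k <;> cases B k <;> rfl
    rw [h1]
    by_cases hk : ∃ i, n i = k
    · obtain ⟨i, rfl⟩ := hk
      have h2 : (∃ j, n j = n i ∧ s j ≠ 0) ↔ s i ≠ 0 := by simp [hn.injective.eq_iff]
      rw [h2]
      have ha := hAn i
      have hb := hBn i
      rcases hs i with h | h | h <;> rw [h] at ha hb ⊢ <;> norm_num at ha hb <;> simp [ha, hb]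
    · have ha : A k = false := by
        rw [Bool.eq_false_iff, Ne, hA]; exact fun ⟨i, hi, _⟩ => hk ⟨i, hi⟩
      have hb : B k = false := by
        rw [Bool.eq_false_iff, Ne, hB]; exact fun ⟨i, hi, _⟩ => hk ⟨i, hi⟩
      rw [ha, hb]
      exact ⟨fun h => absurd h (by decide), fun ⟨i, hi, _⟩ => (hk ⟨i, hi⟩).elim⟩
  obtain ⟨hA1, hA2⟩ := hz A fun k hk => by
    obtain ⟨i, hi, _⟩ := (hA k).1 hk
    exact ⟨i, hi⟩
  obtain ⟨hB1, hB2⟩ := hz B fun k hk => by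
    obtain ⟨i, hi, _⟩ := (hB k).1 hk
    exact ⟨i, hi⟩
  have hpick : ∀ (D : ℕ → Bool) i, pickMask D (n i) =
      if D (n i) = true then fun j => decide (j = n i) else fun _ => false := by
    intro D i
    funext j
    by_cases hj : j = n i
    · subst hj
      cases h : D (n i) <;> simp [pickMask, h]
    · split_ifs <;> simp [pickMask, hj]
  have hz0 : toggle z (fun _ => false) = z := by funext j; simp [toggle]
  have hmain : (fun k => s (β k) * v k) - (θ (toggle z A) - θ (toggle z B)) ∈ L := by
    -- 6 = 1 + 1 + 2 + 2: two tail errors, and two continuity errors doubled by `le_tsum`.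
    refine hN.glue l _ hl hl0 (ne_top_of_le_ne_top (b := ∑' i, 6 * (2⁻¹ : ℝ≥0∞) ^ i) ?_ ?_)
    · rw [ENNReal.tsum_mul_left, ENNReal.tsum_geometric]
      norm_num
    refine ENNReal.tsum_le_tsum fun i => ?_
    let A' := θ (toggle z (truncMask A (n i + 1)))
    let B' := θ (toggle z (truncMask B (n i + 1)))
    let A'' := θ (toggle z (pickMask A (n i)))
    let B'' := θ (toggle z (pickMask B (n i)))
    have hblock : cut (l i) (l (i + 1)) (fun k => s (β k) * v k) =
        cut (l i) (l (i + 1)) (A'' - B'') := by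
      funext k
      rw [cut_apply, cut_apply]
      split_ifs with hk
      swap
      · rfl
      have hβk := hβ i k hk.1 hk.2
      simp only [A'', B'', hpick, hv, hβk, Pi.sub_apply]
      have ha := hAn i
      have hb := hBn i
      rcases hs i with h | h | h <;> rw [h] at ha hb ⊢ <;> norm_num at ha hb <;>
        simp [ha, hb, hz0]
    have hdec : cut (l i) (l (i + 1)) ((fun k => s (β k) * v k) -
          (θ (toggle z A) - θ (toggle z B))) =
        (cut (l i) (l (i + 1)) (B' - B'') - cut (l i) (l (i + 1)) (A' - A'')) +
        (cut (l i) (l (i + 1)) (θ (toggle z B) - B') -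
          cut (l i) (l (i + 1)) (θ (toggle z A) - A')) := by
      rw [cut_sub, hblock]
      simp only [cut_sub]
      abel
    rw [hdec]
    have e1 : ∀ D : ℕ → Bool, (∑ k ∈ Finset.range (l (i + 1)),
          ‖θ (toggle z D) k - θ (toggle z (truncMask D (n i + 1))) k‖ₑ ≤
            (2⁻¹ : ℝ≥0∞) ^ (i + 1)) →
        N (cut (l i) (l (i + 1)) (θ (toggle z D) - θ (toggle z (truncMask D (n i + 1))))) ≤
          2 * (2⁻¹ : ℝ≥0∞) ^ i := by
      intro D hD
      refine (hN.cut_le_sum _ _ _).trans ?_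
      gcongr
      refine hD.trans ?_
      exact pow_le_pow_of_le_one (zero_le) (by norm_num) (Nat.le_succ i)
    calc _ ≤ ((2⁻¹ : ℝ≥0∞) ^ i + (2⁻¹ : ℝ≥0∞) ^ i) +
          (2 * (2⁻¹ : ℝ≥0∞) ^ i + 2 * (2⁻¹ : ℝ≥0∞) ^ i) :=
          (hN.add_le _ _).trans (add_le_add
            ((hN.sub_le _ _).trans (add_le_add (hB2 i _ _ le_rfl) (hA2 i _ _ le_rfl)))
            ((hN.sub_le _ _).trans (add_le_add (e1 B (hB1 i)) (e1 A (hA1 i)))))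
      _ = 6 * (2⁻¹ : ℝ≥0∞) ^ i := by ring
  rw [← hCAB, ← hJ]
  constructor
  · intro h
    have := L.sub_mem h hmain
    rwa [sub_sub_cancel] at this
  · intro h
    have := L.add_mem hmain h
    rwa [sub_add_cancel] at this

/-! ## The variation along chains -/

/-- The total variation of `a` along the chains `j ↦ φ (i, j)`. -/
noncomputable def chainVar (φ : ℕ × ℕ ≃ ℕ) (a : ℕ → ℝ) : ℝ≥0∞ :=
  ∑' p : ℕ × ℕ, ‖a (φ p) - a (φ (p.1, p.2 + 1))‖ₑ

theorem mem_bvZeroInfty_iff {φ : ℕ × ℕ ≃ ℕ} {a : ℕ → ℝ} :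
    a ∈ bvZeroInfty φ ↔ chainVar φ a ≠ ∞ ∧ Tendsto a atTop (𝓝 0) := by
  rw [chainVar, tsum_enorm_ne_top_iff_summable_norm]
  rfl

theorem enorm_le_tsum_enorm_sub {f : ℕ → ℝ} (hf : Tendsto f atTop (𝓝 0)) :
    ‖f 0‖ₑ ≤ ∑' j, ‖f j - f (j + 1)‖ₑ := by
  have h1 : ∀ n, ‖f 0‖ₑ ≤ ‖f n‖ₑ + ∑' j, ‖f j - f (j + 1)‖ₑ := by
    intro n
    have h2 : f 0 = f n + ∑ j ∈ Finset.range n, (f j - f (j + 1)) := by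
      rw [Finset.sum_range_sub']; ring
    calc ‖f 0‖ₑ = ‖f n + ∑ j ∈ Finset.range n, (f j - f (j + 1))‖ₑ := by rw [← h2]
      _ ≤ ‖f n‖ₑ + ‖∑ j ∈ Finset.range n, (f j - f (j + 1))‖ₑ := enorm_add_le _ _
      _ ≤ ‖f n‖ₑ + ∑' j, ‖f j - f (j + 1)‖ₑ := by
        gcongr
        exact (enorm_sum_le _ _).trans (ENNReal.sum_le_tsum _)
  have h3 : Tendsto (fun n => ‖f n‖ₑ + ∑' j, ‖f j - f (j + 1)‖ₑ) atTop
      (𝓝 (0 + ∑' j, ‖f j - f (j + 1)‖ₑ)) :=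
    (tendsto_zero_iff_enorm_tendsto_zero.1 hf).add tendsto_const_nhds
  rw [zero_add] at h3
  exact ge_of_tendsto' h3 h1

section

variable {φ : ℕ × ℕ ≃ ℕ}

theorem tendsto_chain (hφ : ∀ i : ℕ, StrictMono fun j : ℕ => φ (i, j)) {a : ℕ → ℝ}
    (ha : Tendsto a atTop (𝓝 0)) (i j : ℕ) :
    Tendsto (fun k => a (φ (i, j + k))) atTop (𝓝 0) :=
  ha.comp ((hφ i).tendsto_atTop.comp (tendsto_atTop_mono (fun k => Nat.le_add_left k j) tendsto_id))

theorem enorm_le_chainVar (hφ : ∀ i : ℕ, StrictMono fun j : ℕ => φ (i, j)) {a : ℕ → ℝ}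
    (ha : Tendsto a atTop (𝓝 0)) (k : ℕ) : ‖a k‖ₑ ≤ chainVar φ a := by
  obtain ⟨⟨i, j⟩, rfl⟩ := φ.surjective k
  refine (enorm_le_tsum_enorm_sub (tendsto_chain hφ ha i j)).trans ?_
  exact ENNReal.tsum_comp_le_tsum_of_injective (f := fun k => (i, j + k))
    (fun k k' h => by simpa using h) fun p : ℕ × ℕ => ‖a (φ p) - a (φ (p.1, p.2 + 1))‖ₑ

theorem chainVar_sub_le (a b : ℕ → ℝ) : chainVar φ (a - b) ≤ chainVar φ a + chainVar φ b := by
  rw [chainVar, chainVar, chainVar, ← ENNReal.tsum_add]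
  refine ENNReal.tsum_le_tsum fun p => ?_
  refine le_trans (le_of_eq ?_) enorm_sub_le
  simp only [Pi.sub_apply]
  congr 1
  ring

/-- Discarding the coordinates below p creates at most one new jump per chain. Its size is the value
at the first retained point, which is at most the retained variation because a tends to 0 along the
chain; hence the factor 2. -/
theorem chainVar_tail_le (hφ : ∀ i : ℕ, StrictMono fun j : ℕ => φ (i, j)) {a : ℕ → ℝ}
    (ha : Tendsto a atTop (𝓝 0)) (p : ℕ) :
    chainVar φ (Set.indicator (Set.Ici p) a) ≤ 2 * ∑' π : ℕ × ℕ,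
      if p ≤ φ π then ‖a (φ π) - a (φ (π.1, π.2 + 1))‖ₑ else 0 := by
  rw [chainVar, ENNReal.tsum_prod', ENNReal.tsum_prod', ← ENNReal.tsum_mul_left]
  refine ENNReal.tsum_le_tsum fun i => ?_
  have h1 : ∀ j, ‖Set.indicator (Set.Ici p) a (φ (i, j)) -
        Set.indicator (Set.Ici p) a (φ (i, j + 1))‖ₑ ≤
      (if p ≤ φ (i, j) then ‖a (φ (i, j)) - a (φ (i, j + 1))‖ₑ else 0) +
        if φ (i, j) < p ∧ p ≤ φ (i, j + 1) then ‖a (φ (i, j + 1))‖ₑ else 0 := by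
    intro j
    have h2 : φ (i, j) < φ (i, j + 1) := hφ i (Nat.lt_succ_self j)
    by_cases h3 : p ≤ φ (i, j)
    · simp [h3, h3.trans h2.le, not_lt.2 h3]
    · by_cases h4 : p ≤ φ (i, j + 1)
      · simp [h3, h4, not_le.1 h3]
      · simp [h3, h4]
  refine (ENNReal.tsum_le_tsum h1).trans ?_
  rw [ENNReal.tsum_add, two_mul]
  refine add_le_add le_rfl ?_
  by_cases hj : ∃ j, φ (i, j) < p ∧ p ≤ φ (i, j + 1)
  · obtain ⟨j, hj1, hj2⟩ := hj
    rw [tsum_eq_single j, if_pos ⟨hj1, hj2⟩]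
    · refine (enorm_le_tsum_enorm_sub (tendsto_chain hφ ha i (j + 1))).trans ?_
      refine le_trans (ENNReal.tsum_le_tsum fun k => ?_)
        (ENNReal.tsum_comp_le_tsum_of_injective (f := fun k => j + 1 + k)
          (fun k k' h => by simpa using h) fun j =>
            if p ≤ φ (i, j) then ‖a (φ (i, j)) - a (φ (i, j + 1))‖ₑ else 0)
      rw [if_pos (hj2.trans ((hφ i).monotone (Nat.le_add_right _ _)))]
      exact le_rfl
    · intro j' hj'
      refine if_neg fun h => ?_
      rcases lt_or_gt_of_ne hj' with h2 | h2
      · exact absurd ((hφ i).monotone (Nat.succ_le_of_lt h2)) (not_le.2 (hj1.trans_le h.2))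
      · exact absurd ((hφ i).monotone (Nat.succ_le_of_lt h2)) (not_le.2 (h.1.trans_le hj2))
  · push Not at hj
    rw [ENNReal.tsum_eq_zero.2 fun j => if_neg fun h => absurd h.2 (not_le.2 (hj j h.1))]
    exact zero_le

theorem sum_range_cut {l : ℕ → ℕ} (hl : Monotone l) (hl0 : l 0 = 0) (a : ℕ → ℝ) (I : ℕ) :
    ∑ i ∈ Finset.range I, cut (l i) (l (i + 1)) a = cut 0 (l I) a := by
  induction I with
  | zero => funext k; simp [cut_apply, hl0]
  | succ I ih =>
    rw [Finset.sum_range_succ, ih]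
    funext k
    have := hl (Nat.le_succ I)
    simp only [Pi.add_apply, cut_apply]
    by_cases h1 : k < l I
    · simp [h1, not_le.2 h1, h1.trans_le this]
    · simp [h1, not_lt.1 h1]

theorem isTailGauge_chainVar (hφ : ∀ i : ℕ, StrictMono fun j : ℕ => φ (i, j)) :
    IsTailGauge (bvZeroInfty φ) (chainVar φ) where
  measurable := by
    have h : ∀ p : ℕ × ℕ, Measurable fun a : ℕ → ℝ => a (φ p) - a (φ (p.1, p.2 + 1)) :=
      fun p => (measurable_pi_apply _).sub (measurable_pi_apply _)
    exact Measurable.tsum fun p => (h p).enorm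
  sub_le := chainVar_sub_le
  le_tsum a := by
    have h1 : chainVar φ a ≤ ∑' p : ℕ × ℕ, (‖a (φ p)‖ₑ + ‖a (φ (p.1, p.2 + 1))‖ₑ) :=
      ENNReal.tsum_le_tsum fun p => enorm_sub_le
    refine h1.trans ?_
    rw [ENNReal.tsum_add, two_mul]
    refine add_le_add (φ.tsum_eq fun k => ‖a k‖ₑ).le ?_
    refine ENNReal.tsum_comp_le_tsum_of_injective (f := fun p : ℕ × ℕ => φ (p.1, p.2 + 1))
      (fun p p' h => ?_) fun k => ‖a k‖ₑ
    have := φ.injective h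
    simp only [Prod.mk.injEq, add_left_inj] at this
    exact Prod.ext this.1 this.2
  small a ha ε hε := by
    obtain ⟨hv, h0⟩ := mem_bvZeroInfty_iff.1 ha
    set t : ℕ × ℕ → ℝ≥0∞ := fun p => ‖a (φ p) - a (φ (p.1, p.2 + 1))‖ₑ with ht
    have h1 := ENNReal.tendsto_tsum_compl_atTop_zero (f := t) hv
    have hε4 : 0 < ε / 4 := ENNReal.div_pos hε.ne' (by norm_num)
    obtain ⟨s, hs⟩ := (h1.eventually (gt_mem_nhds hε4)).exists
    have h2 : ∀ p, s.sup φ + 1 ≤ p → (∑' π : ℕ × ℕ, if p ≤ φ π then t π else 0) ≤ ε / 4 := by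
      intro p hp
      refine le_trans ?_ hs.le
      have h3 := tsum_subtype {x | x ∉ s} t
      refine le_trans (ENNReal.tsum_le_tsum fun π => ?_) h3.ge
      by_cases hπ : π ∈ s
      · have : φ π ≤ s.sup φ := Finset.le_sup hπ
        rw [if_neg (by omega)]
        exact zero_le
      · rw [Set.indicator_of_mem (show π ∈ {x | x ∉ s} from hπ)]
        split_ifs <;> simp
    refine ⟨s.sup φ + 1, fun p q hp => ?_⟩
    rcases le_total q p with hpq | hpq
    · have : cut p q a = 0 := by
        funext k
        rw [cut_apply, if_neg (by omega)]
        rfl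
      rw [this]
      simp [chainVar]
    have h4 : cut p q a = Set.indicator (Set.Ici p) a - Set.indicator (Set.Ici q) a := by
      funext k
      simp only [cut_apply, Pi.sub_apply, Set.indicator_apply, Set.mem_Ici]
      by_cases h5 : p ≤ k <;> by_cases h6 : k < q
      · simp [h5, h6, not_le.2 h6]
      · simp [h5, h6, not_lt.1 h6]
      · simp [h5, h6]
      · omega
    rw [h4]
    calc _ ≤ 2 * (ε / 4) + 2 * (ε / 4) := (chainVar_sub_le _ _).trans (add_le_add
          ((chainVar_tail_le hφ h0 p).trans (mul_le_mul_right (h2 p hp) _))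
          ((chainVar_tail_le hφ h0 q).trans (mul_le_mul_right (h2 q (hp.trans hpq)) _)))
      _ = 4 * (ε / 4) := by ring
      _ = ε := ENNReal.mul_div_cancel (by norm_num) (by norm_num)
  glue l a hl hl0 hsum := by
    have hx : ∀ I x, x < l I → ∑ i ∈ Finset.range I, cut (l i) (l (i + 1)) a x = a x := by
      intro I x hxI
      have := congr_fun (sum_range_cut hl.monotone hl0 a I) x
      rw [Finset.sum_apply] at this
      rw [this, cut_apply, if_pos ⟨Nat.zero_le _, hxI⟩]
    refine mem_bvZeroInfty_iff.2 ⟨ne_top_of_le_ne_top hsum ?_, ?_⟩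
    · unfold chainVar
      rw [ENNReal.tsum_comm]
      refine ENNReal.tsum_le_tsum fun p => ?_
      set I := max (φ p) (φ (p.1, p.2 + 1)) + 1
      have h1 : φ p < l I := lt_of_lt_of_le (by omega) hl.le_apply
      have h2 : φ (p.1, p.2 + 1) < l I := lt_of_lt_of_le (by omega) hl.le_apply
      rw [← hx I _ h1, ← hx I _ h2, ← Finset.sum_sub_distrib]
      refine (enorm_sum_le _ _).trans ((Finset.sum_le_sum fun i _ => ?_).trans
        (ENNReal.sum_le_tsum (Finset.range I)))
      rfl
    · obtain ⟨β, -, hβ, hβl⟩ := exists_block_index hl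
      have h1 := (ENNReal.tendsto_atTop_zero_of_tsum_ne_top hsum).comp hβ
      rw [tendsto_zero_iff_enorm_tendsto_zero]
      refine tendsto_of_tendsto_of_tendsto_of_le_of_le tendsto_const_nhds h1
        (fun _ => zero_le) fun k => ?_
      have hk : l (β k) ≤ k ∧ k < l (β k + 1) := by
        obtain ⟨i, hi1, hi2⟩ : ∃ i, l i ≤ k ∧ k < l (i + 1) := by
          by_contra! h
          have : ∀ i, l i ≤ k := fun i => by
            induction i with
            | zero => omega
            | succ i ih => exact h i ih
          have h3 := this (k + 1)
          have h4 := hl.le_apply (x := k + 1)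
          omega
        rw [hβl i k hi1 hi2]
        exact ⟨hi1, hi2⟩
      have h2 : cut (l (β k)) (l (β k + 1)) a k = a k := by rw [cut_apply, if_pos hk]
      -- A block has finite support, so the pointwise bound by the variation applies to it, and
      -- block variations tend to 0.
      have h3 : Tendsto (cut (l (β k)) (l (β k + 1)) a) atTop (𝓝 0) := by
        refine tendsto_const_nhds.congr' ?_
        filter_upwards [eventually_ge_atTop (l (β k + 1))] with x hx
        rw [cut_apply, if_neg (by omega)]
      have h4 := enorm_le_chainVar hφ h3 k
      rwa [h2] at h4

end

/-! ## Weighted ideals as sources of reductions -/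

/-- The weight `1 / (c + 1)`, where `c` is the class of `i`. -/
noncomputable def classWeight (i : ℕ) : ℝ := 1 / ((i.unpair.1 : ℝ) + 1)

theorem classWeight_pos (i : ℕ) : 0 < classWeight i := by
  unfold classWeight; positivity

/-- Solidity makes membership of a difference of two selections depend only on their symmetric
difference. Since n i has the same class as i, the weights are unchanged when the coordinates n i
are renumbered. -/
theorem exists_block_form_of_borelReducible {L₀ L : Submodule ℝ (ℕ → ℝ)}
    {N : (ℕ → ℝ) → ℝ≥0∞} (hN : IsTailGauge L N)
    (hsolid : ∀ a b : ℕ → ℝ, (∀ k, |a k| = |b k|) → a ∈ L₀ → b ∈ L₀)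
    (hfin : ∀ (a : ℕ → ℝ) (F : Finset ℕ), (∀ k ∉ F, a k = 0) → a ∈ L₀)
    (hcomp : ∀ (n : ℕ → ℕ) (a : ℕ → ℝ), StrictMono n → (∀ k ∉ Set.range n, a k = 0) →
      (a ∘ n ∈ L₀ ↔ a ∈ L₀))
    (h : BorelReducible (seqMod L₀) (seqMod L)) :
    ∃ β : ℕ → ℕ, Monotone β ∧ Tendsto β atTop atTop ∧ ∃ v : ℕ → ℝ, ∀ s : ℕ → ℝ,
      (∀ i, s i = 0 ∨ s i = 1 ∨ s i = -1) →
      ((fun k => s (β k) * v k) ∈ L ↔ (fun i => s i * classWeight i) ∈ L₀) := by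
  classical
  obtain ⟨f, hf, hfe⟩ := h
  let src : (ℕ → Bool) → ℕ → ℝ := fun x k => if x k = true then classWeight k else 0
  have hsrc : Measurable src := by
    refine (continuous_pi fun k => ?_).measurable
    exact (continuous_of_discreteTopology
      (f := fun b : Bool => if b = true then classWeight k else 0)).comp (continuous_apply k)
  have hsolid' : ∀ a b : ℕ → ℝ, (∀ k, |a k| = |b k|) → (a ∈ L₀ ↔ b ∈ L₀) :=
    fun a b hab => ⟨hsolid a b hab, hsolid b a fun k => (hab k).symm⟩
  obtain ⟨n, hn, hcl, β, hβm, hβt, v, hv⟩ := exists_block_form hN (θ := fun x => f (src x))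
    (hf.comp hsrc) (J := fun x => src x ∈ L₀)
    (fun x y => by
      have h1 : src x - src y ∈ L₀ ↔ f (src x) - f (src y) ∈ L := hfe (src x) (src y)
      rw [← h1]
      refine hsolid' _ _ fun k => ?_
      by_cases hx : x k = true <;> by_cases hy : y k = true <;> simp [src, toggle, hx, hy])
    (fun F => hfin _ F fun k hk => by simp [src, finMask, hk])
  refine ⟨β, hβm, hβt, v, fun s hs => ?_⟩
  rw [hv s hs (fun k => decide (∃ i, n i = k ∧ s i ≠ 0)) (fun k => by rw [decide_eq_true_iff]),
    ← hcomp n _ hn]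
  · refine hsolid' _ _ fun i => ?_
    have h1 : (∃ j, n j = n i ∧ s j ≠ 0) ↔ s i ≠ 0 := by simp [hn.injective.eq_iff]
    have h2 : classWeight (n i) = classWeight i := by simp [classWeight, hcl]
    simp only [src, Function.comp_apply, decide_eq_true_iff, h1, h2]
    rcases hs i with h | h | h <;> simp [h]
  · intro k hk
    refine if_neg ?_
    rw [decide_eq_true_iff]
    exact fun ⟨i, hi, _⟩ => hk ⟨i, hi⟩

/-! ## `ℝ^ℕ / c₀` is not reducible to `ℝ^ℕ / bv₀^(∞)` -/

theorem mem_cZero {a : ℕ → ℝ} : a ∈ cZero ↔ Tendsto a atTop (𝓝 0) := Iff.rfl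

theorem cZero_solid (a b : ℕ → ℝ) (h : ∀ k, |a k| = |b k|) (ha : a ∈ cZero) : b ∈ cZero := by
  rw [mem_cZero, tendsto_zero_iff_abs_tendsto_zero] at ha ⊢
  exact ha.congr h

theorem mem_cZero_of_finite (a : ℕ → ℝ) (F : Finset ℕ) (h : ∀ k ∉ F, a k = 0) : a ∈ cZero := by
  refine mem_cZero.2 (tendsto_const_nhds.congr' ?_)
  filter_upwards [eventually_gt_atTop (F.sup id)] with k hk
  exact (h k fun hF => absurd (Finset.le_sup (f := id) hF) (not_le.2 hk)).symm

theorem comp_mem_cZero_iff (n : ℕ → ℕ) (a : ℕ → ℝ) (hn : StrictMono n)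
    (h : ∀ k ∉ Set.range n, a k = 0) : a ∘ n ∈ cZero ↔ a ∈ cZero := by
  refine ⟨fun H => ?_, fun H => (mem_cZero.1 H).comp hn.tendsto_atTop⟩
  rw [mem_cZero, Metric.tendsto_atTop] at H ⊢
  intro ε hε
  obtain ⟨I, hI⟩ := H ε hε
  refine ⟨n I, fun k hk => ?_⟩
  by_cases hr : k ∈ Set.range n
  · obtain ⟨i, rfl⟩ := hr
    exact hI i (hn.le_iff_le.1 hk)
  · rw [h k hr]; simpa using hε

open Classical in
/-- The sequence `v`, restricted to the blocks (the fibres of `β`) with index in `S`. -/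
noncomputable def blockRestrict (β : ℕ → ℕ) (v : ℕ → ℝ) (S : Set ℕ) : ℕ → ℝ :=
  fun k => if β k ∈ S then v k else 0

theorem blockRestrict_singleton (β : ℕ → ℕ) (v : ℕ → ℝ) (i k : ℕ) :
    blockRestrict β v {i} k = if β k = i then v k else 0 := by
  simp [blockRestrict]

open Classical in
-- Each increment involves at most two blocks, so the triangle inequality applies termwise.
theorem chainVar_blockRestrict_le (φ : ℕ × ℕ ≃ ℕ) (β : ℕ → ℕ) (v : ℕ → ℝ) (S : Set ℕ) :
    chainVar φ (blockRestrict β v S) ≤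
      ∑' i, if i ∈ S then chainVar φ (blockRestrict β v {i}) else 0 := by
  have h1 : ∀ i, (if i ∈ S then chainVar φ (blockRestrict β v {i}) else 0) =
      ∑' p : ℕ × ℕ, if i ∈ S then ‖blockRestrict β v {i} (φ p) -
        blockRestrict β v {i} (φ (p.1, p.2 + 1))‖ₑ else 0 := by
    intro i
    split_ifs
    · rfl
    · simp
  simp_rw [h1]
  rw [ENNReal.tsum_comm]
  refine ENNReal.tsum_le_tsum fun p => ?_
  generalize φ p = x
  generalize φ (p.1, p.2 + 1) = y
  have h2 : ∀ u ∈ ({x, y} : Finset ℕ), blockRestrict β v S u =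
      ∑ i ∈ {β x, β y}, if i ∈ S then blockRestrict β v {i} u else 0 := by
    intro u hu
    rw [Finset.sum_eq_single (β u)]
    · simp [blockRestrict]
    · intro i _ hi
      simp [blockRestrict_singleton, hi.symm]
    · intro hu'
      simp only [Finset.mem_insert, Finset.mem_singleton] at hu hu'
      rcases hu with rfl | rfl <;> simp at hu'
  rw [h2 x (by simp), h2 y (by simp), ← Finset.sum_sub_distrib]
  refine (enorm_sum_le _ _).trans (le_trans (Finset.sum_le_sum fun i _ => ?_)
    (ENNReal.sum_le_tsum {β x, β y}))
  split_ifs <;> simp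

open Classical in
-- Under `hT` each increment meets at most one block of T, so no cancellation between blocks can
-- occur.
theorem le_chainVar_blockRestrict (φ : ℕ × ℕ ≃ ℕ) (β : ℕ → ℕ) (v : ℕ → ℝ) (T : Set ℕ)
    (hT : ∀ p : ℕ × ℕ, β (φ p) ∈ T → β (φ (p.1, p.2 + 1)) ∈ T →
      β (φ p) = β (φ (p.1, p.2 + 1))) :
    ∑' i, (if i ∈ T then chainVar φ (blockRestrict β v {i}) else 0) ≤
      chainVar φ (blockRestrict β v T) := by
  have h1 : ∀ i, (if i ∈ T then chainVar φ (blockRestrict β v {i}) else 0) =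
      ∑' p : ℕ × ℕ, if i ∈ T then ‖blockRestrict β v {i} (φ p) -
        blockRestrict β v {i} (φ (p.1, p.2 + 1))‖ₑ else 0 := by
    intro i
    split_ifs
    · rfl
    · simp
  simp_rw [h1]
  rw [ENNReal.tsum_comm]
  refine ENNReal.tsum_le_tsum fun p => ?_
  have hp := hT p
  generalize φ p = x at hp ⊢
  generalize φ (p.1, p.2 + 1) = y at hp ⊢
  by_cases hi : ∃ i ∈ T, i = β x ∨ i = β y
  · obtain ⟨i, hiT, hi⟩ := hi
    have h3 : ∀ j ∈ T, j = β x ∨ j = β y → j = i := by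
      rintro j hjT (rfl | rfl) <;> rcases hi with rfl | rfl
      · rfl
      · exact hp hjT hiT
      · exact (hp hiT hjT).symm
      · rfl
    rw [tsum_eq_single i, if_pos hiT]
    · refine le_of_eq ?_
      have h4 : ∀ u, u = x ∨ u = y → blockRestrict β v {i} u = blockRestrict β v T u := by
        intro u hu
        rw [blockRestrict_singleton]
        by_cases h5 : β u ∈ T
        · have : β u = i := h3 _ h5 (by rcases hu with rfl | rfl <;> simp)
          simp [blockRestrict, this, hiT]
        · have : β u ≠ i := fun h => h5 (h ▸ hiT)
          simp [blockRestrict, this, h5]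
      rw [h4 x (.inl rfl), h4 y (.inr rfl)]
    · intro j hj
      split_ifs with hjT
      · have h5 : β x ≠ j := fun h => hj (h3 j hjT (.inl h.symm))
        have h6 : β y ≠ j := fun h => hj (h3 j hjT (.inr h.symm))
        simp [blockRestrict_singleton, h5, h6]
      · rfl
  · push Not at hi
    rw [ENNReal.tsum_eq_zero.2 fun j => ?_]
    · exact zero_le
    · split_ifs with hjT
      · simp [blockRestrict_singleton, (hi j hjT).1.symm, (hi j hjT).2.symm]
      · rfl

theorem exists_sparse_seq {φ : ℕ × ℕ ≃ ℕ} (hφ : ∀ i : ℕ, StrictMono fun j : ℕ => φ (i, j))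
    {β : ℕ → ℕ} (hβm : Monotone β) (hβt : Tendsto β atTop atTop) :
    ∃ f : ℕ → ℕ, StrictMono f ∧ (∀ t, (f t).unpair.1 = t.unpair.1) ∧
      ∀ p : ℕ × ℕ, β (φ p) ∈ Set.range f → β (φ (p.1, p.2 + 1)) ∈ Set.range f →
        β (φ p) = β (φ (p.1, p.2 + 1)) := by
  -- Only finitely many coordinates lie in blocks up to a, so their chain successors reach boundedly
  -- many blocks. The next selected block is taken beyond that bound.
  have hM : ∀ a, ∃ M, ∀ p : ℕ × ℕ, β (φ p) ≤ a → β (φ (p.1, p.2 + 1)) ≤ M := by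
    intro a
    obtain ⟨K, hK⟩ := eventually_atTop.1 (hβt.eventually_gt_atTop a)
    refine ⟨(Finset.range K).sup fun k => β (φ ((φ.symm k).1, (φ.symm k).2 + 1)),
      fun p hp => ?_⟩
    have h1 : φ p ∈ Finset.range K := by
      rw [Finset.mem_range]
      by_contra h
      exact absurd (hK _ (not_lt.1 h)) (not_lt.2 hp)
    have h2 := Finset.le_sup (f := fun k => β (φ ((φ.symm k).1, (φ.symm k).2 + 1))) h1
    simpa using h2
  choose M hM using hM
  obtain ⟨f, hf0, hf⟩ := exists_seq (P := fun a : ℕ => a.unpair.1 = (0 : ℕ).unpair.1)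
    (R := fun i a b => a < b ∧ M a < b ∧ b.unpair.1 = (i + 1).unpair.1) ⟨0, rfl⟩ fun i a => by
      obtain ⟨b, hb, hbc⟩ := exists_ge_unpair_fst (i + 1).unpair.1 (a + M a + 1)
      exact ⟨b, by omega, by omega, hbc⟩
  have hmono : StrictMono f := strictMono_nat_of_lt_succ fun i => (hf i).1
  refine ⟨f, hmono, ?_, ?_⟩
  · rintro (_ | t)
    · exact hf0
    · exact (hf t).2.2
  · rintro ⟨i, j⟩ ⟨t, ht⟩ ⟨t', ht'⟩
    have h1 : β (φ (i, j)) ≤ β (φ (i, j + 1)) := hβm ((hφ i) (Nat.lt_succ_self j)).le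
    have h2 := hM (f t) (i, j) ht.ge
    refine le_antisymm h1 ?_
    simp only at h1 h2 ht ht' ⊢
    rw [← ht, ← ht'] at h1 ⊢
    rw [← ht'] at h2
    have h3 : f t' < f (t + 1) := h2.trans_lt (hf t).2.1
    exact hmono.monotone (Nat.lt_succ_iff.1 (hmono.lt_iff_lt.1 h3))

theorem not_borelReducible_cZero_bvZeroInfty {φ : ℕ × ℕ ≃ ℕ}
    (hφ : ∀ i : ℕ, StrictMono fun j : ℕ => φ (i, j)) :
    ¬ BorelReducible (seqMod cZero) (seqMod (bvZeroInfty φ)) := by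
  classical
  intro hred
  obtain ⟨β, hβm, hβt, v, hv⟩ := exists_block_form_of_borelReducible (isTailGauge_chainVar hφ)
    cZero_solid mem_cZero_of_finite comp_mem_cZero_iff hred
  have hW : ∀ S : Set ℕ, blockRestrict β v S ∈ bvZeroInfty φ ↔
      Tendsto (fun i => if i ∈ S then classWeight i else 0) atTop (𝓝 0) := by
    intro S
    have h1 := hv (fun i => if i ∈ S then 1 else 0) fun i => by split_ifs <;> simp
    simp only [ite_mul, one_mul, zero_mul] at h1
    exact h1
  set g : ℕ → ℝ≥0∞ := fun i => chainVar φ (blockRestrict β v {i}) with hg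
  obtain ⟨f, hf, hfc, hfT⟩ := exists_sparse_seq hφ hβm hβt
  obtain ⟨S, hS⟩ : ∃ S : ℕ → Set ℕ, ∀ c i, i ∈ S c ↔ i ∈ Set.range f ∧ i.unpair.1 = c :=
    ⟨fun c => {i | i ∈ Set.range f ∧ i.unpair.1 = c}, fun c i => Iff.rfl⟩
  have hvle : ∀ k, ‖v k‖ₑ ≤ g (β k) := by
    intro k
    have h1 : Tendsto (blockRestrict β v {β k}) atTop (𝓝 0) := by
      refine tendsto_const_nhds.congr' ?_
      filter_upwards [hβt.eventually_gt_atTop (β k)] with x hx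
      rw [blockRestrict_singleton, if_neg hx.ne']
    have h2 := enorm_le_chainVar hφ h1 k
    rwa [blockRestrict_singleton, if_pos rfl] at h2
  -- A finite sum would give finite variation and, by `hvle`, convergence to 0; but the weight is
  -- constantly 1/(c+1) on the infinite set S c.
  have hinf : ∀ c, ∑' i, (if i ∈ S c then g i else 0) = ∞ := by
    intro c
    by_contra hne
    have hmem : blockRestrict β v (S c) ∈ bvZeroInfty φ := by
      refine mem_bvZeroInfty_iff.2
        ⟨ne_top_of_le_ne_top hne (chainVar_blockRestrict_le φ β v (S c)), ?_⟩
      rw [tendsto_zero_iff_enorm_tendsto_zero]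
      refine tendsto_of_tendsto_of_tendsto_of_le_of_le tendsto_const_nhds
        ((ENNReal.tendsto_atTop_zero_of_tsum_ne_top hne).comp hβt) (fun _ => zero_le) fun k => ?_
      simp only [blockRestrict, Function.comp_apply]
      split_ifs
      · exact hvle k
      · simp
    have h1 := (hW _).1 hmem
    have h2 : Tendsto (fun j => f (Nat.pair c j)) atTop atTop :=
      hf.tendsto_atTop.comp (tendsto_atTop_mono (fun j => Nat.right_le_pair c j) tendsto_id)
    have h3 := h1.comp h2
    have h4 : ∀ j, ((fun i => if i ∈ S c then classWeight i else 0) ∘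
        fun j => f (Nat.pair c j)) j = 1 / ((c : ℝ) + 1) := by
      intro j
      have h5 : (f (Nat.pair c j)).unpair.1 = c := by rw [hfc]; simp
      have h6 : f (Nat.pair c j) ∈ S c := (hS _ _).2 ⟨⟨_, rfl⟩, h5⟩
      simp [h6, classWeight, h5]
    have h7 := tendsto_nhds_unique (h3.congr h4) tendsto_const_nhds
    have : (0 : ℝ) < 1 / ((c : ℝ) + 1) := by positivity
    exact this.ne h7
  have hfinset : ∀ c, ∃ F : Finset ℕ, 1 ≤ ∑ i ∈ F, if i ∈ S c then g i else 0 := by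
    intro c
    have h1 := hinf c
    rw [ENNReal.tsum_eq_iSup_sum] at h1
    have h2 : (1 : ℝ≥0∞) < ⨆ F : Finset ℕ, ∑ i ∈ F, if i ∈ S c then g i else 0 := by
      rw [h1]; exact ENNReal.one_lt_top
    obtain ⟨F, hF⟩ := lt_iSup_iff.1 h2
    exact ⟨F, hF.le⟩
  choose F hF using hfinset
  obtain ⟨T, hT⟩ : ∃ T : Set ℕ, ∀ i, i ∈ T ↔ i ∈ Set.range f ∧ i ∈ F i.unpair.1 :=
    ⟨{i | i ∈ Set.range f ∧ i ∈ F i.unpair.1}, fun i => Iff.rfl⟩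
  -- T has finitely many indices in each class, so its weights tend to 0.
  have hTmem : blockRestrict β v T ∈ bvZeroInfty φ := by
    rw [hW, Metric.tendsto_atTop]
    intro ε hε
    obtain ⟨c₀, hc₀⟩ := exists_nat_one_div_lt hε
    refine ⟨((Finset.range c₀).biUnion F).sup id + 1, fun i hi => ?_⟩
    rw [Real.dist_eq, sub_zero]
    split_ifs with hiT
    · rw [abs_of_pos (classWeight_pos i)]
      have h1 : c₀ ≤ i.unpair.1 := by
        by_contra h
        have h2 : i ∈ (Finset.range c₀).biUnion F :=
          Finset.mem_biUnion.2 ⟨_, Finset.mem_range.2 (not_le.1 h), ((hT i).1 hiT).2⟩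
        have h3 := Finset.le_sup (f := id) h2
        simp only [id] at h3
        omega
      refine lt_of_le_of_lt ?_ hc₀
      unfold classWeight
      gcongr
    · simpa using hε
  have hTtop : ∑' i, (if i ∈ T then g i else 0) = ∞ := by
    have h1 : ∀ i, (if i ∈ T then g i else 0) =
        ∑' c, if c = i.unpair.1 then (if i ∈ T then g i else 0) else 0 := by
      intro i
      rw [tsum_ite_eq]
    rw [tsum_congr h1]
    rw [ENNReal.tsum_comm]
    refine top_unique ?_
    calc (⊤ : ℝ≥0∞) = ∑' _ : ℕ, 1 := (ENNReal.tsum_const_eq_top_of_ne_zero one_ne_zero).symm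
      _ ≤ _ := ENNReal.tsum_le_tsum fun c => (hF c).trans
        ((Finset.sum_le_sum fun i hi => ?_).trans (ENNReal.sum_le_tsum (F c)))
    by_cases hc : i ∈ S c
    · have h2 : c = i.unpair.1 := ((hS _ _).1 hc).2.symm
      have h3 : i ∈ T := (hT i).2 ⟨((hS _ _).1 hc).1, h2 ▸ hi⟩
      rw [if_pos hc, if_pos h2, if_pos h3]
    · rw [if_neg hc]
      exact zero_le
  have h1 := le_chainVar_blockRestrict φ β v T fun p hp hp' => hfT p ((hT _).1 hp).1 ((hT _).1 hp').1
  exact (mem_bvZeroInfty_iff.1 hTmem).1 (top_unique (hTtop.ge.trans h1))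

/-! ## Coefficient spaces -/

section

variable {V : Type*} [NormedAddCommGroup V] [NormedSpace ℝ V]

theorem mem_coef_iff [CompleteSpace V] {x : ℕ → V} {a : ℕ → ℝ} :
    a ∈ coef x ↔ ∀ ε : ℝ, 0 < ε → ∃ l, ∀ p q, l ≤ p →
      ‖∑ n ∈ Finset.Ico p q, a n • x n‖ ≤ ε := by
  have h1 : a ∈ coef x ↔ CauchySeq fun N => ∑ n ∈ Finset.range N, a n • x n :=
    ⟨fun ⟨_, hl⟩ => hl.cauchySeq, fun h => cauchySeq_tendsto_of_complete h⟩
  rw [h1, Metric.cauchySeq_iff]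
  constructor
  · intro h ε hε
    obtain ⟨l, hl⟩ := h ε hε
    refine ⟨l, fun p q hp => ?_⟩
    rcases le_total p q with hpq | hpq
    · rw [Finset.sum_Ico_eq_sub _ hpq, ← dist_eq_norm]
      exact (hl q (hp.trans hpq) p hp).le
    · rw [Finset.Ico_eq_empty_of_le hpq]
      simpa using hε.le
  · intro h ε hε
    obtain ⟨l, hl⟩ := h (ε / 2) (half_pos hε)
    have key : ∀ p q, l ≤ p → p ≤ q → dist (∑ n ∈ Finset.range q, a n • x n)
        (∑ n ∈ Finset.range p, a n • x n) < ε := by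
      intro p q hp hpq
      rw [dist_eq_norm, ← Finset.sum_Ico_eq_sub _ hpq]
      exact (hl p q hp).trans_lt (half_lt_self hε)
    refine ⟨l, fun q hq p hp => ?_⟩
    rcases le_total p q with hpq | hpq
    · exact key p q hp hpq
    · rw [dist_comm]; exact key q p hq hpq

/-- The supremum of the norms of `∑ n ∈ Ico p q, a n • x n`. -/
noncomputable def coefGauge (x : ℕ → V) (a : ℕ → ℝ) : ℝ≥0∞ :=
  ⨆ p : ℕ, ⨆ q : ℕ, ‖∑ n ∈ Finset.Ico p q, a n • x n‖ₑ

theorem le_coefGauge (x : ℕ → V) (a : ℕ → ℝ) (p q : ℕ) :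
    ‖∑ n ∈ Finset.Ico p q, a n • x n‖ₑ ≤ coefGauge x a :=
  le_iSup₂ (f := fun p q : ℕ => ‖∑ n ∈ Finset.Ico p q, a n • x n‖ₑ) p q

theorem sum_cut_smul (x : ℕ → V) (a : ℕ → ℝ) (p q p' q' : ℕ) :
    ∑ n ∈ Finset.Ico p' q', cut p q a n • x n =
      ∑ n ∈ Finset.Ico (max p p') (min q q'), a n • x n := by
  rw [← Finset.Ico_inter_Ico, Finset.inter_comm, ← Finset.filter_mem_eq_inter, Finset.sum_filter]
  refine Finset.sum_congr rfl fun n _ => ?_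
  rw [cut_apply]
  simp only [Finset.mem_Ico]
  split_ifs <;> simp

theorem isTailGauge_coefGauge [CompleteSpace V] {x : ℕ → V} (hx : ∀ n, ‖x n‖ ≤ 1) :
    IsTailGauge (coef x) (coefGauge x) where
  measurable := by
    refine Measurable.iSup fun p => Measurable.iSup fun q => Continuous.measurable ?_
    have h : Continuous fun a : ℕ → ℝ => ∑ n ∈ Finset.Ico p q, a n • x n :=
      continuous_finsetSum _ fun n _ => (continuous_apply n).smul continuous_const
    exact h.enorm
  sub_le a b := by
    refine iSup₂_le fun p q => ?_
    have h : ∑ n ∈ Finset.Ico p q, (a - b) n • x n =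
        ∑ n ∈ Finset.Ico p q, a n • x n - ∑ n ∈ Finset.Ico p q, b n • x n := by
      simp [sub_smul]
    rw [h]
    exact enorm_sub_le.trans (add_le_add (le_coefGauge x a p q) (le_coefGauge x b p q))
  le_tsum a := by
    have h : coefGauge x a ≤ ∑' k, ‖a k‖ₑ := by
      refine iSup₂_le fun p q => (enorm_sum_le _ _).trans ?_
      refine le_trans (Finset.sum_le_sum fun n _ => ?_) (ENNReal.sum_le_tsum (Finset.Ico p q))
      rw [enorm_smul]
      refine mul_le_of_le_one_right' ?_
      rw [← ofReal_norm]
      exact ENNReal.ofReal_le_one.2 (hx n)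
    refine h.trans ?_
    rw [two_mul]
    exact le_self_add
  small a ha ε hε := by
    obtain ⟨r, hr0, hrε⟩ := ENNReal.lt_iff_exists_nnreal_btwn.1 hε
    obtain ⟨l, hl⟩ := mem_coef_iff.1 ha r (by exact_mod_cast hr0)
    refine ⟨l, fun p q hp => iSup₂_le fun p' q' => ?_⟩
    rw [sum_cut_smul]
    refine le_trans ?_ hrε.le
    have h1 := hl (max p p') (min q q') (hp.trans (le_max_left _ _))
    rw [← ofReal_norm]
    exact (ENNReal.ofReal_le_ofReal h1).trans (by simp)
  glue l a hl hl0 hsum := by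
    refine mem_coef_iff.2 fun ε hε => ?_
    have h1 := ENNReal.tendsto_sum_nat_add _ hsum
    obtain ⟨i₀, hi₀⟩ := (h1.eventually (gt_mem_nhds (ENNReal.ofReal_pos.2 hε))).exists
    refine ⟨l i₀, fun p q hp => ?_⟩
    rw [← ENNReal.ofReal_le_ofReal_iff hε.le, ofReal_norm]
    refine le_trans ?_ hi₀.le
    -- Beyond l i₀ the sum splits over the blocks from i₀ on; q of them suffice because q + i₀ ≤ l
    -- (q + i₀).
    have h2 : ∑ n ∈ Finset.Ico p q, a n • x n = ∑ j ∈ Finset.range q,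
        ∑ n ∈ Finset.Ico p q, cut (l (j + i₀)) (l (j + i₀ + 1)) a n • x n := by
      rw [Finset.sum_comm]
      refine Finset.sum_congr rfl fun n hn => ?_
      rw [Finset.mem_Ico] at hn
      rw [← Finset.sum_smul]
      congr 1
      have h3 := congr_fun (sum_range_cut hl.monotone hl0 a (q + i₀)) n
      have hq : q + i₀ ≤ l (q + i₀) := hl.le_apply
      rw [Finset.sum_apply, cut_apply, if_pos ⟨Nat.zero_le _, by omega⟩, add_comm q i₀,
        Finset.sum_range_add] at h3
      rw [← h3, Finset.sum_eq_zero, zero_add]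
      · exact Finset.sum_congr rfl fun j _ => by rw [add_comm i₀ j]
      · intro i hi
        have h4 : l (i + 1) ≤ l i₀ := hl.monotone (Finset.mem_range.1 hi)
        rw [cut_apply, if_neg (by omega)]
    rw [h2]
    exact (enorm_sum_le _ _).trans ((Finset.sum_le_sum fun j _ => le_coefGauge x _ p q).trans
      (ENNReal.sum_le_tsum (Finset.range q)))

end

/-- The unit vectors of `ℝ^m`, repeated periodically. -/
noncomputable def cyclicUnit (m n : ℕ) : Fin m → ℝ := fun i => if (i : ℕ) = n % m then 1 else 0

theorem norm_cyclicUnit_le (m n : ℕ) : ‖cyclicUnit m n‖ ≤ 1 := by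
  rw [pi_norm_le_iff_of_nonneg zero_le_one]
  intro i
  unfold cyclicUnit
  split_ifs <;> simp

/-- Evaluation at `k` on `c₀`. -/
def evalZeroAtInfty (k : ℕ) : ZeroAtInftyContinuousMap ℕ ℝ →+ ℝ where
  toFun f := f k
  map_zero' := rfl
  map_add' _ _ := rfl

theorem abs_evalZeroAtInfty_le (f : ZeroAtInftyContinuousMap ℕ ℝ) (k : ℕ) :
    |evalZeroAtInfty k f| ≤ ‖f‖ := by
  rw [← ZeroAtInftyContinuousMap.norm_toBCF_eq_norm]
  exact f.toBCF.norm_coe_le_norm k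

theorem norm_le_of_evalZeroAtInfty {f : ZeroAtInftyContinuousMap ℕ ℝ} {ε : ℝ} (hε : 0 ≤ ε)
    (h : ∀ k, |evalZeroAtInfty k f| ≤ ε) : ‖f‖ ≤ ε := by
  rw [← ZeroAtInftyContinuousMap.norm_toBCF_eq_norm]
  exact (BoundedContinuousFunction.norm_le hε).2 h

theorem evalZeroAtInfty_csBasis (m n : ℕ) (i : Fin m) (k : ℕ) :
    evalZeroAtInfty k (csBasis m n i) = if k ≤ n / m then cyclicUnit m n i else 0 := by
  unfold csBasis cyclicUnit
  split_ifs with h1 h2 h2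
  · rw [map_sum, Finset.sum_eq_single k]
    · exact Pi.single_eq_same (M := fun _ : ℕ => ℝ) k 1
    · intro j _ hj
      exact Pi.single_eq_of_ne (M := fun _ : ℕ => ℝ) hj.symm 1
    · intro h3
      exact absurd (Finset.mem_range.2 (Nat.lt_succ_of_le h2)) h3
  · rw [map_sum]
    refine Finset.sum_eq_zero fun j hj => ?_
    have : k ≠ j := by rw [Finset.mem_range] at hj; omega
    exact Pi.single_eq_of_ne (M := fun _ : ℕ => ℝ) this 1
  · exact map_zero _
  · exact map_zero _

theorem evalZeroAtInfty_sum_csBasis {m : ℕ} (hm : 1 ≤ m) (a : ℕ → ℝ) (p q : ℕ) (i : Fin m)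
    (k : ℕ) :
    evalZeroAtInfty k ((∑ n ∈ Finset.Ico p q, a n • csBasis m n) i) =
      (∑ n ∈ Finset.Ico (max p (k * m)) q, a n • cyclicUnit m n) i := by
  have h1 : Finset.Ico (max p (k * m)) q = (Finset.Ico p q).filter fun n => k ≤ n / m := by
    ext n
    simp only [Finset.mem_Ico, Finset.mem_filter, Nat.le_div_iff_mul_le (by omega : 0 < m)]
    omega
  rw [h1, Finset.sum_filter, Finset.sum_apply, Finset.sum_apply, map_sum]
  refine Finset.sum_congr rfl fun n _ => ?_
  have h2 : evalZeroAtInfty k ((a n • csBasis m n) i) =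
      a n * evalZeroAtInfty k (csBasis m n i) := rfl
  rw [h2, evalZeroAtInfty_csBasis]
  split_ifs <;> simp

/-- Coordinate k of a sum over [p, q) is the ℝ^m-valued sum over [max p (km), q). Coordinate 0 gives
one Cauchy criterion from the other; conversely the shortened interval still starts beyond the
threshold. -/
theorem cs_eq_coef_cyclicUnit {m : ℕ} (hm : 1 ≤ m) : cs m = coef (cyclicUnit m) := by
  ext a
  rw [cs, mem_coef_iff, mem_coef_iff]
  refine forall₂_congr fun ε hε => exists_congr fun l => ⟨fun h p q hp => ?_, fun h p q hp => ?_⟩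
  · refine (pi_norm_le_iff_of_nonneg hε.le).2 fun i => ?_
    have h1 := evalZeroAtInfty_sum_csBasis hm a p q i 0
    rw [zero_mul, max_eq_left (Nat.zero_le p)] at h1
    rw [← h1]
    exact (abs_evalZeroAtInfty_le _ 0).trans ((norm_le_pi_norm _ i).trans (h p q hp))
  · refine (pi_norm_le_iff_of_nonneg hε.le).2 fun i => norm_le_of_evalZeroAtInfty hε.le fun k => ?_
    rw [evalZeroAtInfty_sum_csBasis hm]
    exact (norm_le_pi_norm _ i).trans (h _ q (hp.trans (le_max_left _ _)))

/-! ## `ℝ^ℕ / ℓ₁` is not reducible to `ℝ^ℕ / cs^(m)` -/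

theorem mem_ellOne {a : ℕ → ℝ} : a ∈ ellOne ↔ Summable fun n => |a n| := Iff.rfl

theorem ellOne_solid (a b : ℕ → ℝ) (h : ∀ k, |a k| = |b k|) (ha : a ∈ ellOne) : b ∈ ellOne :=
  (mem_ellOne.1 ha).congr h

theorem mem_ellOne_of_finite (a : ℕ → ℝ) (F : Finset ℕ) (h : ∀ k ∉ F, a k = 0) : a ∈ ellOne :=
  summable_of_ne_finset_zero (s := F) fun k hk => by simp [h k hk]

theorem comp_mem_ellOne_iff (n : ℕ → ℕ) (a : ℕ → ℝ) (hn : StrictMono n)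
    (h : ∀ k ∉ Set.range n, a k = 0) : a ∘ n ∈ ellOne ↔ a ∈ ellOne :=
  hn.injective.summable_iff (f := fun k => |a k|) fun k hk => by simp [h k hk]

/-- The first index of a block with number at least `i`. -/
theorem exists_block_start {β : ℕ → ℕ} (hβm : Monotone β) (hβt : Tendsto β atTop atTop) :
    ∃ lo : ℕ → ℕ, Monotone lo ∧ Tendsto lo atTop atTop ∧ ∀ i k, lo i ≤ k ↔ i ≤ β k := by
  classical
  have h1 : ∀ i, ∃ k, i ≤ β k := fun i => (hβt.eventually_ge_atTop i).exists
  have h2 : ∀ i k, Nat.find (h1 i) ≤ k ↔ i ≤ β k := fun i k =>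
    ⟨fun h => (Nat.find_spec (h1 i)).trans (hβm h), fun h => Nat.find_min' _ h⟩
  refine ⟨fun i => Nat.find (h1 i), fun i j hij => ?_, ?_, h2⟩
  · exact (h2 i _).2 (hij.trans (Nat.find_spec (h1 j)))
  · refine tendsto_atTop.2 fun K => (eventually_gt_atTop (β K)).mono fun i hi => ?_
    by_contra h
    exact absurd ((h2 i K).1 (not_le.1 h).le) (not_le.2 hi)

section

variable {V : Type*} [NormedAddCommGroup V] [NormedSpace ℝ V]

/-- Otherwise infinitely many bad blocks could be thinned so that the t-th has class at least 2^t.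
Their weights are summable, so the thinned series converges, contradicting the Cauchy criterion. -/
theorem eventually_block_small [CompleteSpace V] {β : ℕ → ℕ} {lo : ℕ → ℕ}
    (hlo : Tendsto lo atTop atTop) (hβlo : ∀ i k, lo i ≤ k ↔ i ≤ β k) {v : ℕ → ℝ} {u : ℕ → V}
    (hv : ∀ s : ℕ → ℝ, (∀ i, s i = 0 ∨ s i = 1 ∨ s i = -1) →
      ((fun k => s (β k) * v k) ∈ coef u ↔ (fun i => s i * classWeight i) ∈ ellOne))
    {f : ℕ → ℕ} (hf : StrictMono f) (hfc : Tendsto (fun t => (f t).unpair.1) atTop atTop)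
    {ε : ℝ} (hε : 0 < ε) :
    ∀ᶠ t in atTop, ∀ p q, lo (f t) ≤ p → q ≤ lo (f t + 1) →
      ‖∑ n ∈ Finset.Ico p q, v n • u n‖ ≤ ε := by
  classical
  by_contra hcon
  have h1 : ∀ n : ℕ, ∃ᶠ t in atTop, (2 ^ n ≤ (f t).unpair.1) ∧
      ¬ ∀ p q, lo (f t) ≤ p → q ≤ lo (f t + 1) → ‖∑ n ∈ Finset.Ico p q, v n • u n‖ ≤ ε :=
    fun n => (hfc.eventually_ge_atTop (2 ^ n)).and_frequently (not_eventually.1 hcon)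
  obtain ⟨g, hg, hgP⟩ := extraction_forall_of_frequently h1
  have hfg : StrictMono fun t => f (g t) := hf.comp hg
  let s : ℕ → ℝ := fun i => if i ∈ Set.range (fun t => f (g t)) then 1 else 0
  have hs : ∀ i, s i = 0 ∨ s i = 1 ∨ s i = -1 := fun i => by
    by_cases h : i ∈ Set.range fun t => f (g t)
    · exact .inr (.inl (if_pos h))
    · exact .inl (if_neg h)
  have hs1 : ∀ t, s (f (g t)) = 1 := fun t => if_pos ⟨t, rfl⟩
  have hmem : (fun i => s i * classWeight i) ∈ ellOne := by
    refine (comp_mem_ellOne_iff (fun t => f (g t)) _ hfg fun i hi => ?_).1 ?_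
    · have : s i = 0 := if_neg hi
      rw [this, zero_mul]
    · refine mem_ellOne.2 (Summable.of_nonneg_of_le (fun _ => abs_nonneg _) (fun t => ?_)
        summable_geometric_two)
      simp only [Function.comp_apply, hs1, one_mul]
      rw [abs_of_pos (classWeight_pos _), classWeight, one_div_pow]
      refine one_div_le_one_div_of_le (by positivity) ?_
      have h2 : ((2 ^ t : ℕ) : ℝ) ≤ ((f (g t)).unpair.1 : ℝ) := Nat.cast_le.2 (hgP t).1
      push_cast at h2
      linarith
  obtain ⟨l, hl⟩ := mem_coef_iff.1 ((hv s hs).2 hmem) ε hε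
  obtain ⟨t, ht⟩ := ((hlo.comp hfg.tendsto_atTop).eventually_ge_atTop l).exists
  refine (hgP t).2 fun p q hp hq => ?_
  have h3 := hl p q (le_trans ht hp)
  refine le_of_eq_of_le (congrArg norm (Finset.sum_congr rfl fun n hn => ?_)) h3
  rw [Finset.mem_Ico] at hn
  have h4 : β n = f (g t) := by
    refine le_antisymm ?_ ((hβlo _ n).1 (hp.trans hn.1))
    by_contra h5
    have h6 := (hβlo (f (g t) + 1) n).2 (not_le.1 h5)
    omega
  rw [h4, hs1, one_mul]

/-- Signs which are `1` along `a`, `-1` along `b` and `0` elsewhere. -/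
theorem exists_alternating_signs {a b : ℕ → ℕ} (hab : ∀ t, a t < b t) (hba : ∀ t, b t < a (t + 1)) :
    ∃ s : ℕ → ℝ, (∀ i, s i = 0 ∨ s i = 1 ∨ s i = -1) ∧
      ∀ t i, a t ≤ i → i < a (t + 1) →
        s i = (if i = a t then 1 else 0) - if i = b t then 1 else 0 := by
  classical
  have ha : StrictMono a := strictMono_nat_of_lt_succ fun t => (hab t).trans (hba t)
  have huniq : ∀ t t' i, a t ≤ i → i < a (t + 1) → a t' ≤ i → i < a (t' + 1) → t' = t := by
    intro t t' i h1 h2 h3 h4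
    have h5 := ha.lt_iff_lt.1 (h1.trans_lt h4)
    have h6 := ha.lt_iff_lt.1 (h3.trans_lt h2)
    omega
  refine ⟨fun i => (if i ∈ Set.range a then 1 else 0) - if i ∈ Set.range b then 1 else 0,
    fun i => ?_, fun t i h1 h2 => ?_⟩
  · by_cases hA : i ∈ Set.range a
    · have hB : i ∉ Set.range b := by
        rintro ⟨t, rfl⟩
        obtain ⟨t', ht'⟩ := hA
        have := huniq t t' (b t) (hab t).le (hba t) ht'.le
          (ht' ▸ ha (Nat.lt_succ_self t'))
        subst this
        exact (hab t').ne ht'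
      simp [hA, hB]
    · by_cases hB : i ∈ Set.range b <;> simp [hA, hB]
  · have hA : i ∈ Set.range a ↔ i = a t := by
      refine ⟨?_, fun h => ⟨t, h.symm⟩⟩
      rintro ⟨t', rfl⟩
      rw [huniq t t' _ h1 h2 le_rfl (ha (Nat.lt_succ_self t'))]
    have hB : i ∈ Set.range b ↔ i = b t := by
      refine ⟨?_, fun h => ⟨t, h.symm⟩⟩
      rintro ⟨t', rfl⟩
      rw [huniq t t' _ h1 h2 (hab t').le (hba t')]
    simp only [hA, hB]

/-- A difference of blocks, taken in order, gives a convergent series if the sums over the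
difference of blocks are summable and the partial sums inside the blocks tend to zero. -/
theorem mem_coef_of_alternating [CompleteSpace V] {β : ℕ → ℕ} {lo : ℕ → ℕ} (hlom : Monotone lo)
    (hlo : Tendsto lo atTop atTop) (hβlo : ∀ i k, lo i ≤ k ↔ i ≤ β k) {v : ℕ → ℝ} {u : ℕ → V}
    {a b : ℕ → ℕ} (hab : ∀ t, a t < b t) (hba : ∀ t, b t < a (t + 1)) {s : ℕ → ℝ}
    (hs : ∀ t i, a t ≤ i → i < a (t + 1) →
      s i = (if i = a t then 1 else 0) - if i = b t then 1 else 0)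
    (hsum : ∀ t, ‖∑ n ∈ Finset.Ico (lo (a t)) (lo (a t + 1)), v n • u n -
      ∑ n ∈ Finset.Ico (lo (b t)) (lo (b t + 1)), v n • u n‖ ≤ (1 / 2) ^ t)
    (hsmall : ∀ ε : ℝ, 0 < ε → ∀ᶠ t in atTop, ∀ i, i = a t ∨ i = b t →
      ∀ p q, lo i ≤ p → q ≤ lo (i + 1) → ‖∑ n ∈ Finset.Ico p q, v n • u n‖ ≤ ε) :
    (fun k => s (β k) * v k) ∈ coef u := by
  have ha : StrictMono a := strictMono_nat_of_lt_succ fun t => (hab t).trans (hba t)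
  let Q : ℕ → V := fun n => ∑ k ∈ Finset.range n, (s (β k) * v k) • u k
  -- Between the starts of blocks a t and a (t+1), the partial sum gains an initial piece of block a
  -- t minus an initial piece of block b t; the minima truncate at n.
  have hQ : ∀ t n, lo (a t) ≤ n → n ≤ lo (a (t + 1)) → Q n - Q (lo (a t)) =
      ∑ k ∈ Finset.Ico (lo (a t)) (min n (lo (a t + 1))), v k • u k -
      ∑ k ∈ Finset.Ico (lo (b t)) (min n (lo (b t + 1))), v k • u k := by
    intro t n h1 h2
    have hfil : ∀ i, a t ≤ i → Finset.Ico (lo i) (min n (lo (i + 1))) =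
        (Finset.Ico (lo (a t)) n).filter fun k => β k = i := by
      intro i hi
      ext k
      have e1 := hβlo i k
      have e2 := hβlo (i + 1) k
      have e3 := hlom hi
      simp only [Finset.mem_Ico, Finset.mem_filter]
      omega
    rw [hfil _ le_rfl, hfil _ (hab t).le, Finset.sum_filter, Finset.sum_filter,
      ← Finset.sum_sub_distrib, ← Finset.sum_Ico_eq_sub _ h1]
    refine Finset.sum_congr rfl fun k hk => ?_
    rw [Finset.mem_Ico] at hk
    have h3 : β k < a (t + 1) := by
      by_contra h
      have := (hβlo (a (t + 1)) k).2 (not_lt.1 h)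
      omega
    rw [hs t (β k) ((hβlo _ _).1 hk.1) h3]
    have hne : a t ≠ b t := (hab t).ne
    split_ifs with h4 h5 <;> simp
  have hstep : ∀ t, dist (Q (lo (a t))) (Q (lo (a (t + 1)))) ≤ 1 * (1 / 2 : ℝ) ^ t := by
    intro t
    have h1 := hQ t (lo (a (t + 1))) (hlom (ha (Nat.lt_succ_self t)).le) le_rfl
    rw [min_eq_right (hlom (Nat.succ_le_of_lt (ha (Nat.lt_succ_self t)))),
      min_eq_right (hlom (Nat.succ_le_of_lt (hba t)))] at h1
    rw [dist_comm, dist_eq_norm, h1, one_mul]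
    exact hsum t
  obtain ⟨x, hx⟩ := cauchySeq_tendsto_of_complete
    (cauchySeq_of_le_geometric (1 / 2) 1 (by norm_num) hstep)
  refine ⟨x, Metric.tendsto_atTop.2 fun ε hε => ?_⟩
  have hε4 : 0 < ε / 4 := by positivity
  obtain ⟨t₀, ht₀⟩ := eventually_atTop.1 ((hsmall _ hε4).and
    (hx.eventually (Metric.ball_mem_nhds x hε4)))
  refine ⟨lo (a t₀), fun n hn => ?_⟩
  obtain ⟨t, ht, h1, h2⟩ : ∃ t, t₀ ≤ t ∧ lo (a t) ≤ n ∧ n < lo (a (t + 1)) := by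
    by_contra! h
    have h3 : ∀ t, t₀ ≤ t → lo (a t) ≤ n := fun t ht =>
      Nat.le_induction hn (fun t ht ih => h t ht ih) t ht
    obtain ⟨t, ht, ht'⟩ := (((hlo.comp ha.tendsto_atTop).eventually_gt_atTop n).and
      (eventually_ge_atTop t₀)).exists
    exact absurd (h3 t ht') (not_le.2 ht)
  obtain ⟨h3, h4⟩ := ht₀ t ht
  have h5 := h3 (a t) (.inl rfl) (lo (a t)) (min n (lo (a t + 1))) le_rfl (min_le_right _ _)
  have h6 := h3 (b t) (.inr rfl) (lo (b t)) (min n (lo (b t + 1))) le_rfl (min_le_right _ _)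
  have h7 : dist (Q n) (Q (lo (a t))) ≤ ε / 4 + ε / 4 := by
    rw [dist_eq_norm, hQ t n h1 h2.le]
    exact (norm_sub_le _ _).trans (add_le_add h5 h6)
  have h8 : dist (Q (lo (a t))) x < ε / 4 := h4
  have h9 := dist_triangle (Q n) (Q (lo (a t))) x
  change dist (Q n) x < ε
  linarith

/-- Bolzano–Weierstrass within one class, where the block sums eventually lie in the unit ball. -/
theorem exists_close_pair [FiniteDimensional ℝ V] {σ : ℕ → V} {K : ℕ}
    (hσ : ∀ᶠ i in atTop, K ≤ (i : ℕ).unpair.1 → ‖σ i‖ ≤ 1) {c : ℕ} (hc : K ≤ c) {η : ℝ}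
    (hη : 0 < η) (M : ℕ) :
    ∃ i j, M < i ∧ i < j ∧ i.unpair.1 = c ∧ j.unpair.1 = c ∧ ‖σ i - σ j‖ ≤ η := by
  obtain ⟨I, hI⟩ := eventually_atTop.1 hσ
  let h : ℕ → ℕ := fun j => Nat.pair c (I + M + 1 + j)
  have hmono : StrictMono h := fun j j' hj => Nat.pair_lt_pair_right c (by omega)
  have hge : ∀ j, I + M + 1 ≤ h j := fun j =>
    (Nat.le_add_right _ j).trans (Nat.right_le_pair c _)
  have hcl : ∀ j, (h j).unpair.1 = c := fun j => by simp [h]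
  have : ProperSpace V := FiniteDimensional.proper_real V
  obtain ⟨x, -, g, hg, hgx⟩ := tendsto_subseq_of_bounded
    (Metric.isBounded_closedBall (x := (0 : V)) (r := 1)) (x := fun j => σ (h j)) fun j => by
      have h1 := hge j
      rw [mem_closedBall_zero_iff]
      exact hI _ (by omega) (by rw [hcl]; exact hc)
  obtain ⟨T, hT⟩ := Metric.cauchySeq_iff.1 hgx.cauchySeq η hη
  refine ⟨h (g T), h (g (T + 1)), by have := hge (g T); omega, hmono (hg (Nat.lt_succ_self T)),
    hcl _, hcl _, ?_⟩
  rw [← dist_eq_norm]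
  exact (hT T le_rfl (T + 1) (Nat.le_succ T)).le

theorem not_borelReducible_ellOne_coef [FiniteDimensional ℝ V] {u : ℕ → V}
    (hu : ∀ n, ‖u n‖ ≤ 1) : ¬ BorelReducible (seqMod ellOne) (seqMod (coef u)) := by
  intro hred
  have : CompleteSpace V := FiniteDimensional.complete ℝ V
  obtain ⟨β, hβm, hβt, v, hv⟩ := exists_block_form_of_borelReducible (isTailGauge_coefGauge hu)
    ellOne_solid mem_ellOne_of_finite comp_mem_ellOne_iff hred
  obtain ⟨lo, hlom, hlo, hβlo⟩ := exists_block_start hβm hβt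
  let D : ℕ → ℝ → Prop := fun i ε => ∀ p q, lo i ≤ p → q ≤ lo (i + 1) →
    ‖∑ n ∈ Finset.Ico p q, v n • u n‖ ≤ ε
  -- Otherwise there are blocks of class tending to infinity with a partial sum exceeding 1.
  obtain ⟨K, hK⟩ : ∃ K, ∀ᶠ i in atTop, K ≤ (i : ℕ).unpair.1 → D i 1 := by
    by_contra! hcon
    obtain ⟨f, hf, hfP⟩ := extraction_forall_of_frequently hcon
    have hfc : Tendsto (fun t => (f t).unpair.1) atTop atTop :=
      tendsto_atTop_mono (fun t => (hfP t).1) tendsto_id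
    obtain ⟨t, ht⟩ := (eventually_block_small hlo hβlo hv hf hfc one_pos).exists
    exact (hfP t).2 ht
  let σ : ℕ → V := fun i => ∑ n ∈ Finset.Ico (lo i) (lo (i + 1)), v n • u n
  have hσ : ∀ᶠ i in atTop, K ≤ (i : ℕ).unpair.1 → ‖σ i‖ ≤ 1 :=
    hK.mono fun i hi hc => hi hc _ _ le_rfl le_rfl
  let good : ℕ → ℕ × ℕ → Prop := fun t x => x.1 < x.2 ∧ x.1.unpair.1 = K + t ∧
    x.2.unpair.1 = K + t ∧ ‖σ x.1 - σ x.2‖ ≤ (1 / 2) ^ t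
  have hgood : ∀ t M, ∃ x : ℕ × ℕ, M < x.1 ∧ good t x := fun t M => by
    obtain ⟨i, j, h1, h2, h3, h4, h5⟩ := exists_close_pair hσ (Nat.le_add_right K t)
      (η := (1 / 2 : ℝ) ^ t) (by positivity) M
    exact ⟨(i, j), h1, h2, h3, h4, h5⟩
  obtain ⟨f, hf0, hf⟩ := exists_seq (P := good 0)
    (R := fun t x y => x.2 < y.1 ∧ good (t + 1) y)
    ((hgood 0 0).imp fun _ h => h.2) fun t x => hgood (t + 1) x.2
  have hfg : ∀ t, good t (f t) := by
    rintro (_ | t)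
    · exact hf0
    · exact (hf t).2
  have hab : ∀ t, (f t).1 < (f t).2 := fun t => (hfg t).1
  have hba : ∀ t, (f t).2 < (f (t + 1)).1 := fun t => (hf t).1
  have ha : StrictMono fun t => (f t).1 :=
    strictMono_nat_of_lt_succ fun t => (hab t).trans (hba t)
  have hb : StrictMono fun t => (f t).2 :=
    strictMono_nat_of_lt_succ fun t => (hba t).trans (hab (t + 1))
  have hKt : Tendsto (fun t => K + t) atTop atTop :=
    tendsto_atTop_mono (fun t => Nat.le_add_left t K) tendsto_id
  obtain ⟨s, hs, hsi⟩ := exists_alternating_signs hab hba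
  have hmem : (fun k => s (β k) * v k) ∈ coef u := by
    refine mem_coef_of_alternating hlom hlo hβlo hab hba hsi (fun t => (hfg t).2.2.2)
      fun ε hε => ?_
    filter_upwards [eventually_block_small hlo hβlo hv ha
        (hKt.congr fun t => (hfg t).2.1.symm) hε,
      eventually_block_small hlo hβlo hv hb (hKt.congr fun t => (hfg t).2.2.1.symm) hε]
      with t h1 h2
    rintro i (rfl | rfl)
    · exact h1
    · exact h2
  -- Already the +1 positions contribute 1/(K+t+1) for every t, a harmonic tail.
  have h1 := (mem_ellOne.1 ((hv s hs).1 hmem)).comp_injective ha.injective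
  have h2 : ∀ t, ((fun i => |s i * classWeight i|) ∘ fun t => (f t).1) t =
      1 / (((t + (K + 1) : ℕ) : ℝ)) := by
    intro t
    have h3 := hsi t (f t).1 le_rfl (ha (Nat.lt_succ_self t))
    rw [if_pos rfl, if_neg (hab t).ne, sub_zero] at h3
    simp only [Function.comp_apply, h3, one_mul]
    rw [abs_of_pos (classWeight_pos _), classWeight, (hfg t).2.1]
    push_cast
    congr 1
    ring
  have h4 : Summable fun t : ℕ => 1 / (((t + (K + 1) : ℕ) : ℝ)) := h1.congr h2
  exact Real.not_summable_one_div_natCast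
    ((summable_nat_add_iff (f := fun n : ℕ => 1 / (n : ℝ)) (K + 1)).1 h4)

end

/-! ## The main theorem -/

theorem borelReducible_bvZeroInfty (φ : ℕ × ℕ ≃ ℕ) :
    BorelReducible (seqMod (bvZeroInfty φ)) (Setoid.prod (seqMod ellOne) (seqMod cZero)) := by
  refine ⟨fun a => (fun n => a n - a (φ ((φ.symm n).1, (φ.symm n).2 + 1)), a), ?_, fun a b => ?_⟩
  · refine Measurable.prodMk (measurable_pi_iff.2 fun n => ?_) measurable_id
    exact (measurable_pi_apply n).sub (measurable_pi_apply _)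
  · refine and_congr ?_ Iff.rfl
    refine Iff.trans ?_ (φ.summable_iff (f := fun n => |(a n - a (φ ((φ.symm n).1,
      (φ.symm n).2 + 1))) - (b n - b (φ ((φ.symm n).1, (φ.symm n).2 + 1)))|))
    refine summable_congr fun p => ?_
    simp only [Function.comp_apply, Equiv.symm_apply_apply, Pi.sub_apply]
    congr 1
    ring

theorem borelReducible_cZero_prod :
    BorelReducible (seqMod cZero) (Setoid.prod (seqMod ellOne) (seqMod cZero)) :=
  ⟨fun a => (0, a), measurable_const.prodMk measurable_id, fun _ _ =>
    ⟨fun h => ⟨(seqMod ellOne).refl 0, h⟩, fun h => h.2⟩⟩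

theorem BorelReducible.trans {X Y Z : Type*}
    [TopologicalSpace X] [PolishSpace X] [MeasurableSpace X] [BorelSpace X]
    [TopologicalSpace Y] [PolishSpace Y] [MeasurableSpace Y] [BorelSpace Y]
    [TopologicalSpace Z] [PolishSpace Z] [MeasurableSpace Z] [BorelSpace Z]
    {E : Setoid X} {F : Setoid Y} {G : Setoid Z} (h₁ : BorelReducible E F)
    (h₂ : BorelReducible F G) : BorelReducible E G := by
  obtain ⟨f, hf, hfe⟩ := h₁
  obtain ⟨g, hg, hge⟩ := h₂
  exact ⟨g ∘ f, hg.comp hf, fun x y => (hfe x y).trans (hge _ _)⟩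

/-- The direct product `E ⊗ F` of equivalence relations is Mathlib's `Setoid.prod E F`. -/
theorem theorem5p11 :
    (∀ m : ℕ, 1 ≤ m → ¬ BorelReducible (seqMod ellOne) (seqMod (cs m))) ∧
    ∀ φ : ℕ × ℕ ≃ ℕ, (∀ i : ℕ, StrictMono fun j : ℕ => φ (i, j)) →
      ¬ BorelReducible (seqMod cZero) (seqMod (bvZeroInfty φ)) ∧
      StrictBorelReducible (seqMod (bvZeroInfty φ))
        (Setoid.prod (seqMod ellOne) (seqMod cZero)) := by
  refine ⟨fun m hm => ?_, fun φ hφ => ?_⟩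
  · rw [cs_eq_coef_cyclicUnit hm]
    exact not_borelReducible_ellOne_coef (norm_cyclicUnit_le m)
  · have h := not_borelReducible_cZero_bvZeroInfty hφ
    exact ⟨h, borelReducible_bvZeroInfty φ, fun h' => h (borelReducible_cZero_prod.trans h')⟩
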